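/- Let $A$ be a random $m\times d$ matrix with independent entries that are either all standard normal (Gaussian matrix) or all uniform on $\{-1,+1\}$ (Bernoulli matrix). Let $f:\mathbb R^d\to\mathbb R$ be differentiable at $x$ with $\nabla f(x)$ $s$-sparse (at most $s$ nonzero coordinates, $s\ge 1$), and let $y=A\nabla f(x)+e$ with $e\in\mathbb R^m$. Rescale $\tilde A=\frac1{\sqrt m}A$, $\tilde y=\frac1{\sqrt m}y$, $\tilde e=\frac1{\sqrt m}e$. For each of the two types of matrix and each of the two recovery methods below there is a constant $C'>0$, depending only on the type of matrix and the method (not on $d,s,m,\varepsilon$), such that for every $\varepsilon>0$ and every $m$ with $$m\ \ge\ C'\Big(\kappa s\log\frac{ed}{\kappa s}+\log\frac2\varepsilon\Big)$$ there is an event of probability at least $1-\varepsilon$ on which, simultaneously for all such $f$, $x$ and all $e$, an estimate $g$ as described exists and every such estimate satisfies $$\|g-\nabla f(x)\|_2\ \le\ C\,\|\tilde e\|_2 = C\,\frac{\|e\|_2}{\sqrt m}\ \ (\le C\|e\|_2).$$ (a) Basis pursuit, $C=3$, $\kappa=2$, for $s\le d$: $g$ is any minimizer of $\|z\|_1$ subject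 to $\|\tilde A z-\tilde y\|_2\le\|\tilde e\|_2$. (b) CoSaMP, $C=7.21$, $\kappa=4$, for $4s\le d$: $g=x^{n}$ is the $n$-th iterate of CoSaMP with input $(\tilde A,\tilde y,s)$, for any $n\ge N$, where $N$ depends only on the type of matrix, $d$, $s$, $m$, $\nabla f(x)$ and $e$ (not on $A$ or $\varepsilon$). The iteration is $x^0=0$; given $x^n$, let $L$ be a set of indices of $\min(2s,d)$ largest entries in absolute value of $\tilde A^{T}(\tilde y-\tilde A x^n)$, let $u$ minimize $\|\tilde y-\tilde A z\|_2$ over all $z$ supported in $\operatorname{supp}(x^n)\cup L$, and let $x^{n+1}$ keep $s$ largest entries in absolute value of $u$ and set the others to zero (ties broken arbitrarily). -/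

import Mathlib

open MeasureTheory ProbabilityTheory
open scoped ENNReal

noncomputable section

namespace SparseRecovery

/-- The two kinds of random measurement matrix. -/
inductive Ensemble
  | gaussian
  | bernoulli

/-- The Rademacher law: `1` and `-1` with probability `1/2` each. -/
def rademacher : Measure ℝ :=
  (2 : ℝ≥0∞)⁻¹ • Measure.dirac 1 + (2 : ℝ≥0∞)⁻¹ • Measure.dirac (-1)

/-- The law of a single entry: standard normal, respectively Rademacher. -/
def Ensemble.entryLaw : Ensemble → Measure ℝ
  | .gaussian => gaussianReal 0 1
  | .bernoulli => rademacher

/-- `A` is a random matrix whose entries are independent with common law `ν`. -/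
structure IsIIDMatrix {Ω : Type*} [MeasurableSpace Ω] (P : Measure Ω) {m d : ℕ}
    (ν : Measure ℝ) (A : Ω → Matrix (Fin m) (Fin d) ℝ) : Prop where
  hasLaw : ∀ i j, HasLaw (fun ω => A ω i j) ν P
  indep : iIndepFun (fun (ij : Fin m × Fin d) (ω : Ω) => A ω ij.1 ij.2) P

/-- The support of a vector. -/
def vsupp {d : ℕ} (v : EuclideanSpace ℝ (Fin d)) : Finset (Fin d) :=
  Finset.univ.filter fun j => v j ≠ 0

/-- `v` has at most `s` nonzero coordinates. -/
def IsSparse {d : ℕ} (s : ℕ) (v : EuclideanSpace ℝ (Fin d)) : Prop :=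
  (vsupp v).card ≤ s

/-- The `ℓ¹` norm of a vector. -/
def l1norm {d : ℕ} (z : EuclideanSpace ℝ (Fin d)) : ℝ := ∑ j, |z j|

/-- `z` is an output of (quadratically constrained) basis pursuit with matrix `A`, data `y` and
noise level `η`: it minimizes `‖z‖₁` subject to `‖A z - y‖₂ ≤ η`. -/
def IsBasisPursuitSolution {m d : ℕ} (A : Matrix (Fin m) (Fin d) ℝ)
    (y : EuclideanSpace ℝ (Fin m)) (η : ℝ) (z : EuclideanSpace ℝ (Fin d)) : Prop :=
  ‖A.toEuclideanLin z - y‖ ≤ η ∧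
    ∀ w : EuclideanSpace ℝ (Fin d), ‖A.toEuclideanLin w - y‖ ≤ η → l1norm z ≤ l1norm w

/-- `S` is an index set of `k` entries of `u` that are largest in absolute value (all entries if
there are fewer than `k`; ties may be broken arbitrarily). -/
def IsTopIndexSet {d : ℕ} (k : ℕ) (u : EuclideanSpace ℝ (Fin d)) (S : Finset (Fin d)) : Prop :=
  S.card = min k d ∧ ∀ i ∈ S, ∀ j ∉ S, |u j| ≤ |u i|

/-- `w` keeps `k` largest entries of `u` in absolute value and sets the others to zero. -/
def IsHardThreshold {d : ℕ} (k : ℕ) (u w : EuclideanSpace ℝ (Fin d)) : Prop :=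
  ∃ S : Finset (Fin d), IsTopIndexSet k u S ∧ ∀ j, w j = if j ∈ S then u j else 0

/-- `u` minimizes `‖y - A z‖₂` among the vectors `z` supported in `U`. -/
def IsLeastSquaresOn {m d : ℕ} (A : Matrix (Fin m) (Fin d) ℝ) (y : EuclideanSpace ℝ (Fin m))
    (U : Finset (Fin d)) (u : EuclideanSpace ℝ (Fin d)) : Prop :=
  vsupp u ⊆ U ∧
    ∀ z : EuclideanSpace ℝ (Fin d), vsupp z ⊆ U →
      ‖y - A.toEuclideanLin u‖ ≤ ‖y - A.toEuclideanLin z‖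

/-- One iteration of CoSaMP from `x` to `x'`: merge the support of `x` with the positions of `2s`
largest entries of `Aᵀ (y - A x)`, solve least squares on the merged set, and prune to `s`
largest entries. -/
def IsCoSaMPStep {m d : ℕ} (A : Matrix (Fin m) (Fin d) ℝ) (y : EuclideanSpace ℝ (Fin m))
    (s : ℕ) (x x' : EuclideanSpace ℝ (Fin d)) : Prop :=
  ∃ (L : Finset (Fin d)) (u : EuclideanSpace ℝ (Fin d)),
    IsTopIndexSet (2 * s) (A.transpose.toEuclideanLin (y - A.toEuclideanLin x)) L ∧
    IsLeastSquaresOn A y (vsupp x ∪ L) u ∧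
    IsHardThreshold s u x'

/-- `x 0, x 1, x 2, …` is a run of CoSaMP with matrix `A`, data `y` and sparsity level `s`,
started at the zero vector. -/
def IsCoSaMPRun {m d : ℕ} (A : Matrix (Fin m) (Fin d) ℝ) (y : EuclideanSpace ℝ (Fin m))
    (s : ℕ) (x : ℕ → EuclideanSpace ℝ (Fin d)) : Prop :=
  x 0 = 0 ∧ ∀ n, IsCoSaMPStep A y s (x n) (x (n + 1))

/-- The lower bound `C' (κ s log (e d / (κ s)) + log (2 / ε))` on the number of measurements. -/
def measurementBound (C' κ : ℝ) (d s : ℕ) (ε : ℝ) : ℝ :=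
  C' * (κ * s * Real.log (Real.exp 1 * d / (κ * s)) + Real.log (2 / ε))

end SparseRecovery

end

noncomputable section

namespace SparseRecovery

/-! Both parts follow from the restricted isometry property (RIP) of `(1 / √m) • A`. It is a
property of the matrix alone, so one event serves all `f`, `x` and `e`; the function enters only
through the sparse vector `gradient f x`.

Probabilistic half: both entry laws are centred with unit variance and sub-Gaussian parameter 1. For
a unit vector `v` the entries of `A v` are therefore independent, with sub-exponential centred
squares, and Chernoff's bound concentrates `‖A v‖²` around `m` (`exists_concentration`). A half-net
in each coordinate subspace, polarisation and a union bound over supports turn this into RIP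
(`exists_isRestrictedIsometry`). The number of supports, at most `exp (k log (e d / k))`, is what
the measurement bound pays for.

Deterministic half, basis pursuit: the error lies in a cone where its `ℓ¹` norm is at most `2 √s`
times its `ℓ²` norm. The shelling argument extends RIP to such vectors (`abs_inner_sub_inner_le`),
and feasibility bounds the image of the error by `2 ‖e‖`.

Deterministic half, CoSaMP: under RIP of order `4 s` one step contracts the error by `1 / 10` up to
a multiple of `‖e‖`. With noise, the geometric transient eventually falls below `‖e‖`. Without
noise, the support is captured after finitely many steps and the next step is exact. Either way the
iteration count depends on the target and the noise, not on the matrix. -/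

/-! ### The two entry laws: mean, variance and sub-Gaussian parameter. -/

instance : IsProbabilityMeasure rademacher := by
  refine ⟨?_⟩
  simp [rademacher, ENNReal.inv_two_add_inv_two]

instance (ens : Ensemble) : IsProbabilityMeasure ens.entryLaw := by
  cases ens <;> simp only [Ensemble.entryLaw] <;> infer_instance

lemma integral_rademacher (f : ℝ → ℝ) : ∫ x, f x ∂rademacher = (f 1 + f (-1)) / 2 := by
  have h (a : ℝ) : Integrable f ((2 : ℝ≥0∞)⁻¹ • Measure.dirac a) :=
    (integrable_dirac (by simp)).smul_measure (by simp)
  rw [rademacher, integral_add_measure (h _) (h _), integral_smul_measure, integral_smul_measure,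
    integral_dirac, integral_dirac]
  simp
  ring

lemma ae_rademacher_mem_Icc : ∀ᵐ x ∂rademacher, id x ∈ Set.Icc (-1 : ℝ) 1 := by
  rw [rademacher, ae_add_measure_iff]
  constructor <;> refine Measure.ae_smul_measure ?_ _ <;>
    exact (ae_dirac_iff (p := fun x => id x ∈ Set.Icc (-1 : ℝ) 1) measurableSet_Icc).2 (by norm_num)

/-- The Gaussian moment generating function attains the bound; the Rademacher case is Hoeffding's
lemma on `[-1, 1]`. A common parameter lets both ensembles share the rest of the proof. -/
lemma hasSubgaussianMGF_entryLaw (ens : Ensemble) : HasSubgaussianMGF id 1 ens.entryLaw := by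
  cases ens with
  | gaussian =>
    refine ⟨fun t => integrable_exp_mul_gaussianReal t, fun t => ?_⟩
    simp [Ensemble.entryLaw, mgf_id_gaussianReal]
  | bernoulli =>
    have h := hasSubgaussianMGF_of_mem_Icc_of_integral_eq_zero (μ := rademacher) (X := id)
      aemeasurable_id ae_rademacher_mem_Icc (by simp [integral_rademacher])
    have h1 : (‖(1 : ℝ) - -1‖₊ / 2) ^ 2 = 1 := by
      ext; norm_num
    rwa [h1] at h

lemma integral_id_entryLaw (ens : Ensemble) : ∫ x, x ∂ens.entryLaw = 0 := by
  cases ens <;> simp [Ensemble.entryLaw, integral_rademacher]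

lemma variance_entryLaw (ens : Ensemble) : Var[id; ens.entryLaw] = 1 := by
  cases ens with
  | gaussian => simp [Ensemble.entryLaw]
  | bernoulli =>
    rw [variance_of_integral_eq_zero aemeasurable_id (by simp [Ensemble.entryLaw, integral_rademacher])]
    simp [Ensemble.entryLaw, integral_rademacher]

/-! ### Rows of the random matrix tested against a fixed vector. -/

section Rows

variable {Ω : Type*} [MeasurableSpace Ω] {P : Measure Ω} {m d : ℕ}
  {A : Ω → Matrix (Fin m) (Fin d) ℝ}

lemma IsIIDMatrix.aemeasurable {ν : Measure ℝ} (h : IsIIDMatrix P ν A) (i j) :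
    AEMeasurable (fun ω => A ω i j) P := (h.hasLaw i j).aemeasurable

/-- The joint law of all entries is a product measure over pairs; currying the index makes it a
product over rows of the row laws. -/
lemma IsIIDMatrix.iIndepFun_rows [IsProbabilityMeasure P] {ν : Measure ℝ} [IsProbabilityMeasure ν]
    (h : IsIIDMatrix P ν A) : iIndepFun (fun (i : Fin m) ω (j : Fin d) => A ω i j) P := by
  have hm (i : Fin m) : AEMeasurable (fun ω (j : Fin d) => A ω i j) P :=
    aemeasurable_pi_lambda _ fun j => h.aemeasurable i j
  rw [iIndepFun_iff_map_fun_eq_pi_map hm]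
  have hrow (i : Fin m) : P.map (fun ω (j : Fin d) => A ω i j) = Measure.pi fun _ => ν := by
    have h1 := (h.indep.precomp (g := fun j : Fin d => (i, j))
      (fun _ _ hab => (Prod.mk.inj hab).2)).map_fun_eq_pi_map (fun j => h.aemeasurable i j)
    refine h1.trans ?_
    congr 1
    ext1 j
    exact (h.hasLaw i j).map_eq
  have hall : P.map (fun ω (p : Fin m × Fin d) => A ω p.1 p.2) = Measure.pi fun _ => ν := by
    refine (h.indep.map_fun_eq_pi_map (fun p : Fin m × Fin d => h.aemeasurable p.1 p.2)).trans ?_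
    congr 1
    ext1 p
    exact (h.hasLaw p.1 p.2).map_eq
  have hc := Measure.infinitePi_map_curry (fun (_ : Fin m) (_ : Fin d) => ν)
  simp only [Measure.infinitePi_eq_pi] at hc
  simp only [hrow]
  rw [← hc, ← hall]
  exact (AEMeasurable.map_map_of_aemeasurable (MeasurableEquiv.curry (Fin m) (Fin d) ℝ).measurable.aemeasurable
    (aemeasurable_pi_lambda (fun ω (p : Fin m × Fin d) => A ω p.1 p.2)
      fun p => h.aemeasurable p.1 p.2)).symm

lemma IsIIDMatrix.iIndepFun_row {ν : Measure ℝ} (h : IsIIDMatrix P ν A) (i : Fin m) :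
    iIndepFun (fun (j : Fin d) ω => A ω i j) P :=
  h.indep.precomp (g := fun j : Fin d => (i, j)) (fun _ _ hab => (Prod.mk.inj hab).2)

/-- Sub-Gaussian parameters of independent summands add, and `∑ v j ^ 2 = 1`. -/
lemma IsIIDMatrix.hasSubgaussianMGF_row {ens : Ensemble} (h : IsIIDMatrix P ens.entryLaw A)
    (i : Fin m) (v : EuclideanSpace ℝ (Fin d)) (hv : ‖v‖ = 1) :
    HasSubgaussianMGF (fun ω => ∑ j, v j * A ω i j) 1 P := by
  have hind : iIndepFun (fun (j : Fin d) ω => v j * A ω i j) P :=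
    (h.iIndepFun_row i).comp (fun j x => v j * x) (fun j => by fun_prop)
  have h1 := HasSubgaussianMGF.sum_of_iIndepFun hind (s := Finset.univ)
    (c := fun j => ⟨v j ^ 2, sq_nonneg _⟩ * 1) fun j _ => by
      refine HasSubgaussianMGF.const_mul ?_ (v j)
      rw [← HasSubgaussianMGF.id_map_iff (h.aemeasurable i j), (h.hasLaw i j).map_eq]
      exact hasSubgaussianMGF_entryLaw ens
  convert h1
  ext
  rw [EuclideanSpace.norm_eq, Real.sqrt_eq_one] at hv
  rw [NNReal.coe_sum]
  refine Eq.trans ?_ (Finset.sum_congr rfl fun j _ =>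
    show v j ^ 2 = ((⟨v j ^ 2, sq_nonneg _⟩ * 1 : NNReal) : ℝ) from (mul_one (v j ^ 2)).symm)
  simpa using hv.symm

lemma IsIIDMatrix.integral_row_sq {ens : Ensemble} (h : IsIIDMatrix P ens.entryLaw A)
    (i : Fin m) (v : EuclideanSpace ℝ (Fin d)) (hv : ‖v‖ = 1) :
    ∫ ω, (∑ j, v j * A ω i j) ^ 2 ∂P = 1 := by
  have hsub (j : Fin d) : HasSubgaussianMGF (fun ω => A ω i j) 1 P := by
    rw [← HasSubgaussianMGF.id_map_iff (h.aemeasurable i j), (h.hasLaw i j).map_eq]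
    exact hasSubgaussianMGF_entryLaw ens
  have hind : iIndepFun (fun (j : Fin d) ω => v j * A ω i j) P :=
    (h.iIndepFun_row i).comp (fun j x => v j * x) (fun j => by fun_prop)
  have hmean (j : Fin d) : ∫ ω, A ω i j ∂P = 0 := by
    rw [← integral_id_entryLaw ens]
    exact (h.hasLaw i j).integral_comp (f := fun x => x) (by fun_prop)
  have hvar := IndepFun.variance_sum (μ := P) (X := fun (j : Fin d) ω => v j * A ω i j)
    (s := Finset.univ) (fun j _ => ((hsub j).const_mul (v j)).memLp 2)
    (fun j _ k _ hjk => hind.indepFun hjk)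
  rw [variance_of_integral_eq_zero] at hvar
  · simp only [Finset.sum_apply] at hvar
    rw [hvar]
    simp_rw [variance_const_mul, (h.hasLaw i _).variance_eq, variance_entryLaw]
    rw [EuclideanSpace.norm_eq, Real.sqrt_eq_one] at hv
    simpa using hv
  · have := h.aemeasurable i
    fun_prop
  · simp only [Finset.sum_apply]
    rw [integral_finsetSum _ fun j _ => ((hsub j).integrable).const_mul _]
    simp [integral_const_mul, hmean]

end Rows

/-! ### Sub-exponential squares and Chernoff concentration. -/

section Concentration

/-- Keeping the linear term exact matters: it integrates to zero for centred variables, leaving a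
moment generating function bound quadratic in the parameter. -/
lemma exp_le_one_add_add_sq_mul_exp_abs (u : ℝ) :
    Real.exp u ≤ 1 + u + u ^ 2 * Real.exp |u| := by
  rcases le_or_gt |u| 1 with h | h
  · have h1 := (abs_le.1 (Real.abs_exp_sub_one_sub_id_le h)).2
    nlinarith [Real.one_le_exp (abs_nonneg u), sq_nonneg u]
  · have h2 : 1 ≤ u ^ 2 := by nlinarith [sq_abs u]
    have h3 : Real.exp u ≤ Real.exp |u| := Real.exp_le_exp.2 (le_abs_self u)
    rcases le_or_gt 0 u with h0 | h0
    · nlinarith [Real.exp_pos |u|]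
    · have : Real.exp u ≤ 1 := Real.exp_le_one_iff.2 h0.le
      rw [abs_of_neg h0] at *
      nlinarith [Real.one_le_exp (abs_nonneg u), Real.one_le_exp (show 0 ≤ -u by linarith)]

/-- A Gaussian-decoupling bound: variables with sub-Gaussian parameter one have a common
exponential moment of their square. -/
lemma exists_integral_exp_sq_le :
    ∃ c M : ℝ, 0 < c ∧ ∀ {Ω : Type*} [MeasurableSpace Ω] (P : Measure Ω)
      [IsProbabilityMeasure P] (X : Ω → ℝ), HasSubgaussianMGF X 1 P →
      Integrable (fun ω => Real.exp (c * X ω ^ 2)) P ∧ ∫ ω, Real.exp (c * X ω ^ 2) ∂P ≤ M := by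
  obtain ⟨c, hc, hint⟩ := IsGaussian.exists_integrable_exp_sq (gaussianReal 0 1)
  refine ⟨c, ∫ x, Real.exp (c * ‖x‖ ^ 2) ∂gaussianReal 0 1, hc, ?_⟩
  intro Ω _ P _ X hX
  -- With `t = √(2 c)` and a standard normal `g`, one has `exp (c x²) = E exp (t x g)`. After
  -- exchanging the two integrals, the sub-Gaussian bound in `X` at parameter `t g` reproduces the
  -- Gaussian's own moment `E exp (c g²)`, so `c` and `M` do not depend on `X`.
  have hXm := hX.aemeasurable
  set t := √(2 * c) with ht
  have ht2 : t ^ 2 = 2 * c := Real.sq_sqrt (by positivity)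
  have hin (x : ℝ) : ∫⁻ l, ENNReal.ofReal (Real.exp (t * x * l)) ∂gaussianReal 0 1
      = ENNReal.ofReal (Real.exp (c * x ^ 2)) := by
    rw [← ofReal_integral_eq_lintegral_ofReal (integrable_exp_mul_gaussianReal _)
      (ae_of_all _ fun _ => (Real.exp_pos _).le)]
    have := congrFun (mgf_fun_id_gaussianReal (μ := 0) (v := 1)) (t * x)
    rw [mgf] at this
    rw [this, mul_pow, ht2]
    congr 2
    simp
    ring
  have key : ∫⁻ ω, ENNReal.ofReal (Real.exp (c * X ω ^ 2)) ∂P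
      ≤ ENNReal.ofReal (∫ x, Real.exp (c * ‖x‖ ^ 2) ∂gaussianReal 0 1) := by
    simp_rw [← hin]
    rw [lintegral_lintegral_swap]
    · rw [ofReal_integral_eq_lintegral_ofReal hint (ae_of_all _ fun _ => (Real.exp_pos _).le)]
      refine lintegral_mono fun l => ?_
      have h1 := hX.integrable_exp_mul (t * l)
      have h2 := hX.mgf_le (t * l)
      have h3 : ∀ ω, t * X ω * l = t * l * X ω := fun ω => by ring
      simp_rw [h3]
      rw [← ofReal_integral_eq_lintegral_ofReal h1 (ae_of_all _ fun _ => (Real.exp_pos _).le)]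
      refine ENNReal.ofReal_le_ofReal (h2.trans (le_of_eq ?_))
      rw [mul_pow, ht2]
      congr 1
      simp
      ring
    · have := hXm.comp_fst (ν := gaussianReal 0 1)
      unfold Function.uncurry
      fun_prop
  have hi : Integrable (fun ω => Real.exp (c * X ω ^ 2)) P := by
    refine ⟨by fun_prop, ?_⟩
    rw [hasFiniteIntegral_iff_ofReal (ae_of_all _ fun _ => (Real.exp_pos _).le)]
    exact key.trans_lt ENNReal.ofReal_lt_top
  refine ⟨hi, ?_⟩
  rw [← ofReal_integral_eq_lintegral_ofReal hi (ae_of_all _ fun _ => (Real.exp_pos _).le)] at key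
  exact (ENNReal.ofReal_le_ofReal_iff (integral_nonneg fun _ => (Real.exp_pos _).le)).1 key

/-- The centred square of a unit-variance sub-Gaussian variable is sub-exponential. -/
lemma exists_mgf_sq_sub_one_le :
    ∃ t₀ K : ℝ, 0 < t₀ ∧ 0 < K ∧ ∀ {Ω : Type*} [MeasurableSpace Ω] (P : Measure Ω)
      [IsProbabilityMeasure P] (X : Ω → ℝ), HasSubgaussianMGF X 1 P → ∫ ω, X ω ^ 2 ∂P = 1 →
      ∀ t : ℝ, |t| ≤ t₀ → Integrable (fun ω => Real.exp (t * (X ω ^ 2 - 1))) P ∧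
        mgf (fun ω => X ω ^ 2 - 1) P t ≤ Real.exp (K * t ^ 2) := by
  obtain ⟨c, M, hc, h⟩ := exists_integral_exp_sq_le
  -- With `z = |X² - 1|`, half of the exponential budget `exp (c z)` pays for `z² ≤ (8 / c²) exp (c
  -- z / 2)` and half for `exp |t (X² - 1)|`, hence `t₀ = c / 2`. The factor `exp c` comes from `z ≤
  -- X² + 1`; the summand `1` makes `K` positive.
  refine ⟨c / 2, 8 / c ^ 2 * Real.exp c * |M| + 1, by positivity, by positivity, ?_⟩
  intro Ω _ P _ X hX hX2 t ht
  obtain ⟨hi, hM⟩ := h P X hX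
  have hXm := hX.aemeasurable
  have habs (ω : Ω) : |X ω ^ 2 - 1| ≤ X ω ^ 2 + 1 := by
    rw [abs_le]; constructor <;> nlinarith [sq_nonneg (X ω)]
  have hpt (ω : Ω) : (t * (X ω ^ 2 - 1)) ^ 2 * Real.exp |t * (X ω ^ 2 - 1)| ≤
      t ^ 2 * (8 / c ^ 2 * Real.exp c) * Real.exp (c * X ω ^ 2) := by
    set z := |X ω ^ 2 - 1| with hz
    have hz0 : 0 ≤ z := abs_nonneg _
    have h1 : (c / 2 * z) ^ 2 / 2 ≤ Real.exp (c / 2 * z) := by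
      have := Real.pow_div_factorial_le_exp (x := c / 2 * z) (by positivity) 2
      simpa using this
    have h2 : |t * (X ω ^ 2 - 1)| ≤ c / 2 * z := by
      rw [abs_mul]; exact mul_le_mul_of_nonneg_right ht hz0
    have h3 : (X ω ^ 2 - 1) ^ 2 ≤ 8 / c ^ 2 * Real.exp (c / 2 * z) := by
      rw [← sq_abs, ← hz, div_mul_eq_mul_div, le_div_iff₀ (by positivity)]
      nlinarith
    calc (t * (X ω ^ 2 - 1)) ^ 2 * Real.exp |t * (X ω ^ 2 - 1)|
        ≤ t ^ 2 * (8 / c ^ 2 * Real.exp (c / 2 * z)) * Real.exp (c / 2 * z) := by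
          rw [mul_pow]; gcongr
      _ = t ^ 2 * (8 / c ^ 2) * Real.exp (c * z) := by
          rw [show c * z = c / 2 * z + c / 2 * z by ring, Real.exp_add]; ring
      _ ≤ t ^ 2 * (8 / c ^ 2) * Real.exp (c * (X ω ^ 2 + 1)) := by gcongr; exact habs ω
      _ = _ := by rw [mul_add, mul_one, Real.exp_add]; ring
  have hint : Integrable (fun ω => Real.exp (t * (X ω ^ 2 - 1))) P := by
    refine Integrable.mono' (hi.const_mul (Real.exp c)) (by fun_prop) (ae_of_all _ fun ω => ?_)
    rw [Real.norm_eq_abs, abs_of_pos (Real.exp_pos _), ← Real.exp_add]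
    refine Real.exp_le_exp.2 ((le_abs_self _).trans ?_)
    rw [abs_mul]
    have := mul_le_mul ht (habs ω) (abs_nonneg _) (by positivity)
    nlinarith [sq_nonneg (X ω)]
  refine ⟨hint, ?_⟩
  have hX2i : Integrable (fun ω => X ω ^ 2) P := (hX.memLp 2).integrable_sq
  calc mgf (fun ω => X ω ^ 2 - 1) P t
      ≤ ∫ ω, (1 + t * (X ω ^ 2 - 1)
          + t ^ 2 * (8 / c ^ 2 * Real.exp c) * Real.exp (c * X ω ^ 2)) ∂P := by
        refine integral_mono hint ?_ fun ω => ?_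
        · exact ((integrable_const _).add ((hX2i.sub (integrable_const _)).const_mul _)).add
            (hi.const_mul _)
        · exact (exp_le_one_add_add_sq_mul_exp_abs _).trans (add_le_add_right (hpt ω) _)
    _ = 1 + t ^ 2 * (8 / c ^ 2 * Real.exp c) * ∫ ω, Real.exp (c * X ω ^ 2) ∂P := by
        rw [integral_add _ (hi.const_mul _), integral_add (integrable_const _),
          integral_const_mul, integral_const_mul, integral_sub hX2i (integrable_const _), hX2]
        · simp
        · exact (hX2i.sub (integrable_const _)).const_mul _
        · exact (integrable_const _).add ((hX2i.sub (integrable_const _)).const_mul _)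
    _ ≤ 1 + t ^ 2 * (8 / c ^ 2 * Real.exp c) * |M| := by
        gcongr; exact hM.trans (le_abs_self M)
    _ ≤ (8 / c ^ 2 * Real.exp c * |M| + 1) * t ^ 2 + 1 := by nlinarith [sq_nonneg t]
    _ ≤ _ := Real.add_one_le_exp _

/-- Matrix entries are only a.e. measurable, so the measurable version is applied to modifications.
-/
lemma integrable_exp_mul_sum_of_aemeasurable {Ω ι : Type*} [MeasurableSpace Ω] [Fintype ι]
    {P : Measure Ω} [IsProbabilityMeasure P] {Y : ι → Ω → ℝ} {t : ℝ} (h : iIndepFun Y P)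
    (hY : ∀ i, AEMeasurable (Y i) P)
    (hint : ∀ i, Integrable (fun ω => Real.exp (t * Y i ω)) P) :
    Integrable (fun ω => Real.exp (t * (∑ i, Y i) ω)) P := by
  have hmk (i : ι) : Y i =ᵐ[P] (hY i).mk := (hY i).ae_eq_mk
  refine ((h.congr hmk).integrable_exp_mul_sum (t := t) (s := Finset.univ)
    (fun i => (hY i).measurable_mk) fun i _ => (hint i).congr ?_).congr ?_
  · filter_upwards [hmk i] with ω hω
    rw [hω]
  · filter_upwards [ae_all_iff.2 hmk] with ω hω
    simp only [Finset.sum_apply, hω]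

lemma norm_toEuclideanLin_sq {m d : ℕ} (A : Matrix (Fin m) (Fin d) ℝ)
    (v : EuclideanSpace ℝ (Fin d)) :
    ‖A.toEuclideanLin v‖ ^ 2 = ∑ i, (∑ j, v j * A i j) ^ 2 := by
  rw [EuclideanSpace.norm_sq_eq]
  refine Finset.sum_congr rfl fun i _ => ?_
  rw [Real.norm_eq_abs, sq_abs]
  congr 1
  simp [Matrix.toLpLin_apply, Matrix.mulVec, dotProduct, mul_comm]

/-- Concentration of `‖A v‖²` around `m ‖v‖²`. -/
lemma exists_concentration (δ : ℝ) (hδ : 0 < δ) :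
    ∃ c : ℝ, 0 < c ∧ ∀ (ens : Ensemble) {Ω : Type*} [MeasurableSpace Ω] (P : Measure Ω)
      [IsProbabilityMeasure P] (m d : ℕ) (A : Ω → Matrix (Fin m) (Fin d) ℝ),
      IsIIDMatrix P ens.entryLaw A → ∀ v : EuclideanSpace ℝ (Fin d),
      P.real {ω | δ * m * ‖v‖ ^ 2 < |‖(A ω).toEuclideanLin v‖ ^ 2 - m * ‖v‖ ^ 2|}
        ≤ 2 * Real.exp (-c * m) := by
  obtain ⟨t₀, K, ht₀, hK, h⟩ := exists_mgf_sq_sub_one_le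
  -- The Chernoff exponent per row is `K t² - t δ`; this `t` makes it at most `-t δ / 2`.
  set t := min t₀ (δ / (2 * K)) with ht
  have htpos : 0 < t := by positivity
  have htK : K * t ^ 2 ≤ t * δ / 2 := by
    have : t ≤ δ / (2 * K) := min_le_right _ _
    rw [le_div_iff₀ (by positivity)] at this
    nlinarith
  refine ⟨t * δ / 2, by positivity, ?_⟩
  intro ens Ω _ P _ m d A hA v
  -- The event is unchanged when `v` is rescaled, and the strict inequality makes it empty for `v =
  -- 0`.
  wlog hv : ‖v‖ = 1 generalizing v
  · rcases eq_or_ne v 0 with rfl | hv0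
    · simp; positivity
    · have hn : 0 < ‖v‖ := norm_pos_iff.2 hv0
      have h1 := this ((‖v‖)⁻¹ • v) (by rw [norm_smul]; simp [hn.ne'])
      refine le_trans (le_of_eq ?_) h1
      congr 1
      ext ω
      simp only [Set.mem_ofPred_eq, map_smul, norm_smul, norm_inv, norm_norm, mul_pow]
      have h2 : (‖v‖⁻¹) ^ 2 * ‖v‖ ^ 2 = 1 := by field_simp
      rw [h2]
      have h3 : (‖v‖⁻¹) ^ 2 * ‖(A ω).toEuclideanLin v‖ ^ 2 - m * 1
          = (‖v‖⁻¹) ^ 2 * (‖(A ω).toEuclideanLin v‖ ^ 2 - m * ‖v‖ ^ 2) := by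
        rw [mul_sub, ← h2]; ring
      rw [h3, abs_mul, abs_of_nonneg (by positivity : (0 : ℝ) ≤ (‖v‖⁻¹) ^ 2), inv_pow,
        ← div_eq_inv_mul, lt_div_iff₀ (by positivity), mul_one]
  set X : Fin m → Ω → ℝ := fun i ω => ∑ j, v j * A ω i j with hX
  set Y : Fin m → Ω → ℝ := fun i ω => X i ω ^ 2 - 1 with hY
  have hXm (i : Fin m) : AEMeasurable (X i) P := (hA.hasSubgaussianMGF_row i v hv).aemeasurable
  have hYind : iIndepFun Y P :=
    hA.iIndepFun_rows.comp (fun _ r => (∑ j, v j * r j) ^ 2 - 1) (fun _ => by fun_prop)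
  have hYm (i : Fin m) : AEMeasurable (Y i) P := by fun_prop
  have hb (i : Fin m) (s : ℝ) (hs : |s| ≤ t₀) := h P (X i) (hA.hasSubgaussianMGF_row i v hv)
    (hA.integral_row_sq i v hv) s hs
  have hsum (ω : Ω) : ‖(A ω).toEuclideanLin v‖ ^ 2 - m * ‖v‖ ^ 2 = (∑ i, Y i) ω := by
    simp [norm_toEuclideanLin_sq, hv, hY, hX]
  have hmgf (s : ℝ) (hs : |s| = t) : Integrable (fun ω => Real.exp (s * (∑ i, Y i) ω)) P ∧
      mgf (∑ i, Y i) P s ≤ Real.exp (t * δ / 2 * m) := by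
    have hs' : |s| ≤ t₀ := hs.le.trans (min_le_left _ _)
    constructor
    · exact integrable_exp_mul_sum_of_aemeasurable hYind hYm fun i => (hb i s hs').1
    · rw [hYind.mgf_sum₀ hYm]
      calc ∏ i, mgf (Y i) P s ≤ ∏ _i : Fin m, Real.exp (t * δ / 2) := by
            refine Finset.prod_le_prod (fun _ _ => mgf_nonneg) fun i _ => ?_
            refine (hb i s hs').2.trans (Real.exp_le_exp.2 ?_)
            rw [← sq_abs, hs]; exact htK
        _ = _ := by simp [← Real.exp_nat_mul, mul_comm]
  obtain ⟨hi1, hm1⟩ := hmgf t (abs_of_pos htpos)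
  obtain ⟨hi2, hm2⟩ := hmgf (-t) (by rw [abs_neg, abs_of_pos htpos])
  have hU := measure_ge_le_exp_mul_mgf (μ := P) (X := ∑ i, Y i) (δ * m) htpos.le hi1
  have hL := measure_le_le_exp_mul_mgf (μ := P) (X := ∑ i, Y i) (-(δ * m)) (neg_nonpos.2 htpos.le)
    hi2
  have hexp : Real.exp (-(t * δ / 2) * m) = Real.exp (-t * (δ * m)) * Real.exp (t * δ / 2 * m) := by
    rw [← Real.exp_add]; congr 1; ring
  calc P.real {ω | δ * m * ‖v‖ ^ 2 < |‖(A ω).toEuclideanLin v‖ ^ 2 - m * ‖v‖ ^ 2|}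
      ≤ P.real ({ω | δ * m ≤ (∑ i, Y i) ω} ∪ {ω | (∑ i, Y i) ω ≤ -(δ * m)}) := by
        refine measureReal_mono fun ω hω => ?_
        rw [Set.mem_ofPred_eq, hsum, hv, one_pow, mul_one] at hω
        rcases lt_abs.1 hω with h | h
        · exact Or.inl h.le
        · exact Or.inr (by simp only [Set.mem_ofPred_eq]; linarith)
    _ ≤ _ := measureReal_union_le _ _
    _ ≤ Real.exp (-(t * δ / 2) * m) + Real.exp (-(t * δ / 2) * m) := by
        rw [hexp]
        refine add_le_add (hU.trans (by gcongr)) (hL.trans ?_)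
        have : -(-t) * -(δ * m) = -t * (δ * m) := by ring
        rw [this]
        gcongr
    _ = _ := by ring

end Concentration

/-- Restricted isometry of order `k` with constant `δ`, in polarised form. -/
def IsRestrictedIsometry {m d : ℕ} (B : Matrix (Fin m) (Fin d) ℝ) (k : ℕ) (δ : ℝ) : Prop :=
  ∀ u v : EuclideanSpace ℝ (Fin d), (vsupp u ∪ vsupp v).card ≤ k →
    |inner ℝ (B.toEuclideanLin u) (B.toEuclideanLin v) - inner ℝ u v| ≤ δ * (‖u‖ * ‖v‖)

/-! ### Nets and the reduction of RIP to finitely many test vectors. -/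

section Net

/-- A 1-separated set of largest cardinality in the ball of radius 2 has at most `5 ^ dim` points by
volume comparison. Halved, it is a half-net of the unit ball: if `v` were far from it, `2 v` could
be added to the separated set. -/
lemma exists_half_net {F : Type*} [NormedAddCommGroup F] [NormedSpace ℝ F]
    [FiniteDimensional ℝ F] :
    ∃ N : Finset F, N.card ≤ 5 ^ Module.finrank ℝ F ∧ (∀ n ∈ N, ‖n‖ ≤ 1) ∧
      ∀ v : F, ‖v‖ ≤ 1 → ∃ n ∈ N, ‖v - n‖ ≤ 1 / 2 := by
  classical
  set T : Set ℕ := {k | ∃ s : Finset F, ((∀ c ∈ s, ‖c‖ ≤ 2) ∧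
    ∀ c ∈ s, ∀ d ∈ s, c ≠ d → 1 ≤ ‖c - d‖) ∧ s.card = k} with hT
  have hbdd : BddAbove T := by
    refine ⟨5 ^ Module.finrank ℝ F, ?_⟩
    rintro _ ⟨s, h, rfl⟩
    exact Besicovitch.card_le_of_separated s h.1 h.2
  obtain ⟨s, ⟨hs2, hsep⟩, hcard⟩ := Nat.sSup_mem (s := T) ⟨0, ∅, by simp, by simp⟩ hbdd
  have hmap : Function.Injective fun x : F => (1 / 2 : ℝ) • x :=
    smul_right_injective F (by norm_num)
  refine ⟨s.image fun x => (1 / 2 : ℝ) • x, ?_, ?_, fun v hv => ?_⟩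
  · exact Finset.card_image_le.trans (Besicovitch.card_le_of_separated s hs2 hsep)
  · intro n hn
    obtain ⟨x, hx, rfl⟩ := Finset.mem_image.1 hn
    have := hs2 x hx
    rw [norm_smul]; norm_num; linarith
  · by_contra! hcon
    have hfar (x : F) (hx : x ∈ s) : 1 < ‖(2 : ℝ) • v - x‖ := by
      have h1 := hcon _ (Finset.mem_image_of_mem _ hx)
      have h2 : (2 : ℝ) • v - x = (2 : ℝ) • (v - (1 / 2 : ℝ) • x) := by
        rw [smul_sub, smul_smul]; norm_num
      rw [h2, norm_smul]; norm_num; linarith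
    have hnot : (2 : ℝ) • v ∉ s := fun h => by simpa using (hfar _ h).trans' one_pos
    have hmem : (insert ((2 : ℝ) • v) s).card ∈ T := by
      refine ⟨_, ⟨?_, ?_⟩, rfl⟩
      · intro c hc
        rcases Finset.mem_insert.1 hc with rfl | hc
        · rw [norm_smul]; norm_num; linarith
        · exact hs2 c hc
      · intro c hc e he hne
        rcases Finset.mem_insert.1 hc with rfl | hc <;> rcases Finset.mem_insert.1 he with rfl | he
        · exact absurd rfl hne
        · exact (hfar e he).le
        · rw [norm_sub_rev]; exact (hfar c hc).le
        · exact hsep c hc e he hne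
    have h3 := le_csSup hbdd hmem
    rw [Finset.card_insert_of_notMem hnot, hcard] at h3
    omega

/-- Approximating a unit vector by a net point gives `‖f‖ ≤ η + ‖f‖ / 2`, and the last term is
absorbed. -/
lemma opNorm_le_of_half_net {F G : Type*} [NormedAddCommGroup F] [NormedSpace ℝ F]
    [NormedAddCommGroup G] [NormedSpace ℝ G] (f : F →L[ℝ] G) {N : Finset F} {η : ℝ} (hη : 0 ≤ η)
    (hN : ∀ v : F, ‖v‖ ≤ 1 → ∃ n ∈ N, ‖v - n‖ ≤ 1 / 2) (h : ∀ n ∈ N, ‖f n‖ ≤ η) :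
    ‖f‖ ≤ 2 * η := by
  have h1 : ‖f‖ ≤ η + ‖f‖ / 2 := by
    refine f.opNorm_le_of_unit_norm (by positivity) fun v hv => ?_
    obtain ⟨n, hn, hvn⟩ := hN v hv.le
    calc ‖f v‖ = ‖f n + f (v - n)‖ := by rw [← map_add]; congr 2; abel
      _ ≤ ‖f n‖ + ‖f‖ * ‖v - n‖ := (norm_add_le _ _).trans (by gcongr; exact f.le_opNorm _)
      _ ≤ η + ‖f‖ * (1 / 2) := by gcongr; exact h n hn
      _ = _ := by ring
  linarith

lemma abs_bilin_le_of_half_net {F : Type*} [NormedAddCommGroup F] [NormedSpace ℝ F]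
    (b : F →L[ℝ] F →L[ℝ] ℝ) {N : Finset F} {δ : ℝ} (hδ : 0 ≤ δ)
    (hN : ∀ v : F, ‖v‖ ≤ 1 → ∃ n ∈ N, ‖v - n‖ ≤ 1 / 2)
    (h : ∀ x ∈ N, ∀ y ∈ N, |b x y| ≤ δ) (x y : F) : |b x y| ≤ 4 * δ * (‖x‖ * ‖y‖) := by
  have hnorm : ‖b‖ ≤ 2 * (2 * δ) :=
    opNorm_le_of_half_net b (by positivity) hN fun x hx =>
      opNorm_le_of_half_net (b x) hδ hN fun y hy => h x hx y hy
  calc |b x y| ≤ ‖b‖ * ‖x‖ * ‖y‖ := b.le_opNorm₂ x y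
    _ ≤ 2 * (2 * δ) * ‖x‖ * ‖y‖ := by gcongr
    _ = _ := by ring

/-- The span of the coordinate vectors indexed by `S`. -/
def coordSpan {d : ℕ} (S : Finset (Fin d)) : Submodule ℝ (EuclideanSpace ℝ (Fin d)) :=
  Submodule.span ℝ (Set.range fun j : S => EuclideanSpace.single (j : Fin d) (1 : ℝ))

lemma finrank_coordSpan_le {d : ℕ} (S : Finset (Fin d)) :
    Module.finrank ℝ (coordSpan S) ≤ S.card := by
  have h := finrank_range_le_card (R := ℝ)
    (fun j : S => EuclideanSpace.single (j : Fin d) (1 : ℝ))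
  rwa [Fintype.card_coe] at h

lemma mem_coordSpan {d : ℕ} {S : Finset (Fin d)} {v : EuclideanSpace ℝ (Fin d)}
    (hv : vsupp v ⊆ S) : v ∈ coordSpan S := by
  have h : v = ∑ j : S, v j • EuclideanSpace.single (j : Fin d) (1 : ℝ) := by
    rw [Finset.sum_coe_sort S fun j => v j • EuclideanSpace.single j (1 : ℝ)]
    ext i
    by_cases hi : i ∈ S
    · simp [Finset.sum_apply, Pi.single_apply, hi]
    · have : v i = 0 := by
        by_contra h0
        exact hi (hv (by simp [vsupp, h0]))
      simp [Finset.sum_apply, Pi.single_apply, hi, this]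
  rw [h]
  exact Submodule.sum_mem _ fun j _ => Submodule.smul_mem _ _ (Submodule.subset_span ⟨j, rfl⟩)

/-- Sums and differences of net points are tested because, for the defect form `b`, `4 b(x, y)` is
the difference of its quadratic values at `x + y` and `x - y`. The parallelogram law then gives `|b|
≤ δ` on the net, and passing to all vectors costs a factor 2 in each variable. `W` is chosen before
`B`, as the union bound for a random `B` requires. -/
lemma exists_coord_testSet {d : ℕ} (S : Finset (Fin d)) :
    ∃ W : Finset (EuclideanSpace ℝ (Fin d)), W.card ≤ 25 ^ S.card * 2 ∧
      ∀ (m : ℕ) (B : Matrix (Fin m) (Fin d) ℝ) (δ : ℝ), 0 ≤ δ →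
        (∀ w ∈ W, |‖B.toEuclideanLin w‖ ^ 2 - ‖w‖ ^ 2| ≤ δ * ‖w‖ ^ 2) →
        ∀ u v : EuclideanSpace ℝ (Fin d), vsupp u ⊆ S → vsupp v ⊆ S →
          |inner ℝ (B.toEuclideanLin u) (B.toEuclideanLin v) - inner ℝ u v|
            ≤ 4 * δ * (‖u‖ * ‖v‖) := by
  classical
  obtain ⟨N, hcard, hN1, hN⟩ := exists_half_net (F := coordSpan S)
  let W₁ := (N ×ˢ N).image fun p => ((p.1 + p.2 : coordSpan S) : EuclideanSpace ℝ (Fin d))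
  let W₂ := (N ×ˢ N).image fun p => ((p.1 - p.2 : coordSpan S) : EuclideanSpace ℝ (Fin d))
  refine ⟨W₁ ∪ W₂, ?_, ?_⟩
  · have h5 : N.card ≤ 5 ^ S.card :=
      hcard.trans (Nat.pow_le_pow_right (by norm_num) (finrank_coordSpan_le S))
    have h25 : (N ×ˢ N).card ≤ 25 ^ S.card := by
      rw [Finset.card_product, show 25 = 5 * 5 by norm_num, mul_pow]
      exact Nat.mul_le_mul h5 h5
    calc (W₁ ∪ W₂).card ≤ W₁.card + W₂.card := Finset.card_union_le _ _
      _ ≤ 25 ^ S.card + 25 ^ S.card :=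
        Nat.add_le_add (Finset.card_image_le.trans h25) (Finset.card_image_le.trans h25)
      _ = _ := by ring
  · intro m B δ hδ hW u v hu hv
    have hb (F : Submodule ℝ (EuclideanSpace ℝ (Fin d))) : ∃ b : F →L[ℝ] F →L[ℝ] ℝ, ∀ x y, b x y =
        inner ℝ (B.toEuclideanLin x) (B.toEuclideanLin y)
          - inner ℝ (x : EuclideanSpace ℝ (Fin d)) y :=
      ⟨(innerSL ℝ).bilinearComp ((LinearMap.toContinuousLinearMap B.toEuclideanLin).comp F.subtypeL)
        ((LinearMap.toContinuousLinearMap B.toEuclideanLin).comp F.subtypeL)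
        - (innerSL ℝ).bilinearComp F.subtypeL F.subtypeL, fun x y => rfl⟩
    obtain ⟨b, hb⟩ := hb (coordSpan S)
    have hpol (x y : coordSpan S) (hx : x ∈ N) (hy : y ∈ N) : |b x y| ≤ δ := by
      have h1 := hW _ (Finset.mem_union_left _ (Finset.mem_image_of_mem _
        (Finset.mk_mem_product hx hy)))
      have h2 := hW _ (Finset.mem_union_right _ (Finset.mem_image_of_mem _
        (Finset.mk_mem_product hx hy)))
      have hx1 := hN1 x hx
      have hy1 := hN1 y hy
      simp only [Submodule.coe_add, Submodule.coe_sub, map_add, map_sub] at h1 h2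
      rw [Submodule.coe_norm] at hx1 hy1
      rw [norm_add_sq_real, norm_add_sq_real] at h1
      rw [norm_sub_sq_real, norm_sub_sq_real] at h2
      rw [hb, abs_le]
      rw [abs_le] at h1 h2
      have hx2 : ‖(x : EuclideanSpace ℝ (Fin d))‖ ^ 2 ≤ 1 := by
        nlinarith [norm_nonneg (x : EuclideanSpace ℝ (Fin d))]
      have hy2 : ‖(y : EuclideanSpace ℝ (Fin d))‖ ^ 2 ≤ 1 := by
        nlinarith [norm_nonneg (y : EuclideanSpace ℝ (Fin d))]
      have hx3 := mul_le_mul_of_nonneg_left hx2 hδ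
      have hy3 := mul_le_mul_of_nonneg_left hy2 hδ
      constructor <;> nlinarith
    have h := abs_bilin_le_of_half_net b hδ hN (fun x hx y hy => hpol x y hx hy)
      ⟨u, mem_coordSpan hu⟩ ⟨v, mem_coordSpan hv⟩
    rwa [hb] at h

lemma exists_testSet {d k : ℕ} (hk : k ≤ d) :
    ∃ W : Finset (EuclideanSpace ℝ (Fin d)), W.card ≤ d.choose k * (25 ^ k * 2) ∧
      ∀ (m : ℕ) (B : Matrix (Fin m) (Fin d) ℝ) (δ : ℝ), 0 ≤ δ →
        (∀ w ∈ W, |‖B.toEuclideanLin w‖ ^ 2 - ‖w‖ ^ 2| ≤ δ * ‖w‖ ^ 2) →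
        IsRestrictedIsometry B k (4 * δ) := by
  classical
  choose W hWc hW using exists_coord_testSet (d := d)
  refine ⟨(Finset.powersetCard k Finset.univ).biUnion W, ?_, ?_⟩
  · refine (Finset.card_biUnion_le_card_mul _ _ (25 ^ k * 2) fun S hS => ?_).trans (by simp)
    rw [← (Finset.mem_powersetCard.1 hS).2]
    exact hWc S
  · intro m B δ hδ h u v huv
    obtain ⟨S, hS, hSk⟩ := Finset.exists_superset_card_eq huv (by simpa using hk)
    exact hW S m B δ hδ (fun w hw => h w (Finset.mem_biUnion.2 ⟨S, by simp [hSk], hw⟩)) u v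
      (Finset.union_subset_left hS) (Finset.union_subset_right hS)

end Net

/-! ### RIP with high probability. -/

/-- From `choose d k ≤ d ^ k / k!` and `k ^ k / k! ≤ exp k`. -/
lemma choose_le_exp {d k : ℕ} (hk : 1 ≤ k) (hkd : k ≤ d) :
    (d.choose k : ℝ) ≤ Real.exp (k * Real.log (Real.exp 1 * d / k)) := by
  have hk0 : (0 : ℝ) < k := by exact_mod_cast hk
  have hd0 : (0 : ℝ) < d := by exact_mod_cast hk.trans hkd
  have h1 : (d.choose k : ℝ) ≤ (d : ℝ) ^ k / k.factorial := Nat.choose_le_pow_div k d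
  have h2 := Real.pow_div_factorial_le_exp (x := (k : ℝ)) hk0.le k
  have h3 : Real.exp (k * Real.log (Real.exp 1 * d / k)) = Real.exp k * d ^ k / k ^ k := by
    rw [Real.exp_nat_mul, Real.exp_log (by positivity), div_pow, mul_pow, ← Real.exp_nat_mul,
      mul_one]
  rw [h3, le_div_iff₀ (by positivity)]
  have hf : (0 : ℝ) < k.factorial := by positivity
  calc (d.choose k : ℝ) * k ^ k ≤ (d : ℝ) ^ k / k.factorial * k ^ k := by gcongr
    _ = (k : ℝ) ^ k / k.factorial * d ^ k := by ring
    _ ≤ _ := by gcongr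

lemma one_le_log_mul_div {d k : ℕ} (hk : 1 ≤ k) (hkd : k ≤ d) :
    1 ≤ Real.log (Real.exp 1 * d / k) := by
  have hk0 : (0 : ℝ) < k := by exact_mod_cast hk
  have hd : (k : ℝ) ≤ d := by exact_mod_cast hkd
  have hd0 : (0 : ℝ) < d := hk0.trans_le hd
  rw [Real.le_log_iff_exp_le (by positivity), le_div_iff₀ hk0]
  gcongr

lemma norm_smul_toEuclideanLin_sq {m d : ℕ} (A : Matrix (Fin m) (Fin d) ℝ)
    (v : EuclideanSpace ℝ (Fin d)) :
    ‖((1 / √(m : ℝ)) • A).toEuclideanLin v‖ ^ 2 = ‖A.toEuclideanLin v‖ ^ 2 / m := by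
  rw [map_smul, LinearMap.smul_apply, norm_smul, mul_pow, Real.norm_eq_abs, sq_abs, div_pow,
    Real.sq_sqrt (Nat.cast_nonneg m)]
  ring

/-- Normalised sub-Gaussian matrices have small restricted isometry constants with high
probability. -/
theorem exists_isRestrictedIsometry (δ : ℝ) (hδ : 0 < δ) :
    ∃ C : ℝ, 0 < C ∧ ∀ (ens : Ensemble) (d k m : ℕ), 1 ≤ k → k ≤ d → ∀ ε : ℝ, 0 < ε → ε < 1 →
      C * (k * Real.log (Real.exp 1 * d / k) + Real.log (2 / ε)) ≤ (m : ℝ) →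
      ∀ {Ω : Type*} [MeasurableSpace Ω] (P : Measure Ω) [IsProbabilityMeasure P]
        (A : Ω → Matrix (Fin m) (Fin d) ℝ), IsIIDMatrix P ens.entryLaw A →
      ∃ E : Set Ω, MeasurableSet E ∧ 1 - ε ≤ P.real E ∧ ∀ ω ∈ E,
        0 < m ∧ IsRestrictedIsometry ((1 / √(m : ℝ)) • A ω) k δ := by
  obtain ⟨c, hc, hconc⟩ := exists_concentration (δ / 4) (by positivity)
  -- The union bound has exponent `k lg + 4 k - c m`, where `4 k` comes from `25 ≤ exp 4`. As `lg ≥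
  -- 1`, the first two terms are at most `5 k lg`, so `c m ≥ 5 (k lg + ℓ)` leaves `-5 ℓ`, and `4 (ε
  -- / 2) ^ 5 ≤ ε`.
  refine ⟨5 / c, by positivity, ?_⟩
  intro ens d k m hk hkd ε hε hε1 hm Ω _ P _ A hA
  set ℓ := Real.log (2 / ε) with hℓ
  set lg := Real.log (Real.exp 1 * d / k) with hlg
  have hℓ0 : 0 < ℓ := Real.log_pos (by rw [lt_div_iff₀ hε]; linarith)
  have hlg1 : 1 ≤ lg := one_le_log_mul_div hk hkd
  have hk1 : (1 : ℝ) ≤ k := by exact_mod_cast hk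
  have hm0 : (0 : ℝ) < m := lt_of_lt_of_le (by positivity) hm
  obtain ⟨W, hWc, hW⟩ := exists_testSet hkd
  set bad : Set Ω := ⋃ w ∈ W,
    {ω | δ / 4 * m * ‖w‖ ^ 2 < |‖(A ω).toEuclideanLin w‖ ^ 2 - m * ‖w‖ ^ 2|} with hbad
  have hPbad : P.real bad ≤ ε := by
    have hcm : 5 * (k * lg + ℓ) ≤ c * m := by
      rw [div_mul_eq_mul_div, div_le_iff₀ hc] at hm
      linarith
    have h25 : (25 : ℝ) ^ k ≤ Real.exp (4 * k) := by
      rw [mul_comm, Real.exp_nat_mul]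
      gcongr
      have := Real.exp_one_gt_d9
      rw [show (4 : ℝ) = ((4 : ℕ) : ℝ) * 1 by norm_num, Real.exp_nat_mul]
      calc (25 : ℝ) ≤ 2.7 ^ 4 := by norm_num
        _ ≤ _ := by gcongr; linarith
    have hexpℓ : Real.exp (-ℓ) = ε / 2 := by
      rw [Real.exp_neg, hℓ, Real.exp_log (by positivity), inv_div]
    calc P.real bad ≤ ∑ w ∈ W, P.real
          {ω | δ / 4 * m * ‖w‖ ^ 2 < |‖(A ω).toEuclideanLin w‖ ^ 2 - m * ‖w‖ ^ 2|} :=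
          measureReal_biUnion_finset_le _ _
      _ ≤ ∑ w ∈ W, 2 * Real.exp (-c * m) := Finset.sum_le_sum fun w _ => hconc ens P m d A hA w
      _ = W.card * (2 * Real.exp (-c * m)) := by simp
      _ ≤ ((d.choose k * (25 ^ k * 2) : ℕ) : ℝ) * (2 * Real.exp (-c * m)) := by
          gcongr
      _ = d.choose k * (25 : ℝ) ^ k * (4 * Real.exp (-c * m)) := by push_cast; ring
      _ ≤ Real.exp (k * lg) * Real.exp (4 * k) * (4 * Real.exp (-c * m)) := by
          gcongr; exact choose_le_exp hk hkd
      _ = 4 * Real.exp (k * lg + 4 * k + -c * m) := by rw [Real.exp_add, Real.exp_add]; ring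
      _ ≤ 4 * Real.exp ((5 : ℕ) * -ℓ) := by
          gcongr
          push_cast
          nlinarith
      _ = 4 * (ε / 2) ^ 5 := by rw [Real.exp_nat_mul, hexpℓ]
      _ ≤ ε := by
          have : ε ^ 5 ≤ ε := pow_le_of_le_one hε.le hε1.le (by norm_num)
          rw [div_pow]; linarith
  -- The entries are only a.e. measurable, so `bad` itself may fail to be measurable.
  refine ⟨(toMeasurable P bad)ᶜ, (measurableSet_toMeasurable P bad).compl, ?_, fun ω hω => ?_⟩
  · rw [probReal_compl_eq_one_sub (measurableSet_toMeasurable P bad), measureReal_def,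
      measure_toMeasurable, ← measureReal_def]
    linarith
  · refine ⟨by exact_mod_cast hm0, ?_⟩
    have hω' : ω ∉ bad := fun h => hω (subset_toMeasurable P bad h)
    have h := hW m ((1 / √(m : ℝ)) • A ω) (δ / 4) (by positivity) fun w hw => ?_
    · convert h using 1; ring
    · have h1 : |‖(A ω).toEuclideanLin w‖ ^ 2 - m * ‖w‖ ^ 2| ≤ δ / 4 * m * ‖w‖ ^ 2 := by
        by_contra! hcon
        exact hω' (Set.mem_biUnion hw hcon)
      rw [norm_smul_toEuclideanLin_sq]
      have h2 : ‖(A ω).toEuclideanLin w‖ ^ 2 / m - ‖w‖ ^ 2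
          = (‖(A ω).toEuclideanLin w‖ ^ 2 - m * ‖w‖ ^ 2) / m := by field_simp
      rw [h2, abs_div, abs_of_pos hm0, div_le_iff₀ hm0]
      linarith

/-! ### Restriction of vectors to index sets. -/

section Restriction

variable {d : ℕ}

lemma mem_vsupp {v : EuclideanSpace ℝ (Fin d)} {j : Fin d} : j ∈ vsupp v ↔ v j ≠ 0 := by
  simp [vsupp]

lemma eq_zero_of_notMem {S : Finset (Fin d)} {v : EuclideanSpace ℝ (Fin d)} (hv : vsupp v ⊆ S)
    {j : Fin d} (hj : j ∉ S) : v j = 0 := by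
  by_contra h
  exact hj (hv (mem_vsupp.2 h))

lemma vsupp_sub_subset (u v : EuclideanSpace ℝ (Fin d)) : vsupp (u - v) ⊆ vsupp u ∪ vsupp v := by
  intro j hj
  rw [mem_vsupp] at hj
  rw [Finset.mem_union, mem_vsupp, mem_vsupp]
  by_contra! h
  simp [h.1, h.2] at hj

/-- The restriction of a vector to an index set, extended by zero. -/
def restr (S : Finset (Fin d)) : EuclideanSpace ℝ (Fin d) →ₗ[ℝ] EuclideanSpace ℝ (Fin d) where
  toFun u := WithLp.toLp 2 fun j => if j ∈ S then u j else 0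
  map_add' u v := by ext j; by_cases h : j ∈ S <;> simp [h]
  map_smul' c u := by ext j; by_cases h : j ∈ S <;> simp [h]

lemma restr_apply (S : Finset (Fin d)) (u : EuclideanSpace ℝ (Fin d)) (j : Fin d) :
    restr S u j = if j ∈ S then u j else 0 := rfl

lemma vsupp_restr_subset (S : Finset (Fin d)) (u : EuclideanSpace ℝ (Fin d)) :
    vsupp (restr S u) ⊆ S := by
  intro j hj
  rw [mem_vsupp, restr_apply] at hj
  by_contra h
  simp [h] at hj

lemma vsupp_restr_subset_vsupp (S : Finset (Fin d)) (u : EuclideanSpace ℝ (Fin d)) :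
    vsupp (restr S u) ⊆ vsupp u := by
  intro j hj
  rw [mem_vsupp, restr_apply] at hj
  rw [mem_vsupp]
  intro h
  simp [h] at hj

lemma restr_add_restr_compl (S : Finset (Fin d)) (u : EuclideanSpace ℝ (Fin d)) :
    restr S u + restr Sᶜ u = u := by
  ext j
  by_cases h : j ∈ S <;> simp [restr_apply, h]

lemma restr_eq_self {S : Finset (Fin d)} {u : EuclideanSpace ℝ (Fin d)} (h : vsupp u ⊆ S) :
    restr S u = u := by
  ext j
  by_cases hj : j ∈ S
  · simp [restr_apply, hj]
  · simp [restr_apply, hj, eq_zero_of_notMem h hj]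

lemma restr_eq_zero {S : Finset (Fin d)} {u : EuclideanSpace ℝ (Fin d)}
    (h : ∀ j ∈ S, u j = 0) : restr S u = 0 := by
  ext j
  by_cases hj : j ∈ S <;> simp [restr_apply, hj, h]

lemma norm_restr_sq (S : Finset (Fin d)) (u : EuclideanSpace ℝ (Fin d)) :
    ‖restr S u‖ ^ 2 = ∑ j ∈ S, u j ^ 2 := by
  rw [EuclideanSpace.norm_sq_eq]
  simp [restr_apply, apply_ite, Finset.sum_ite_mem]

lemma norm_restr_mono {S T : Finset (Fin d)} (h : S ⊆ T) (u : EuclideanSpace ℝ (Fin d)) :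
    ‖restr S u‖ ≤ ‖restr T u‖ := by
  refine le_of_sq_le_sq ?_ (norm_nonneg _)
  rw [norm_restr_sq, norm_restr_sq]
  exact Finset.sum_le_sum_of_subset_of_nonneg h fun _ _ _ => sq_nonneg _

lemma norm_restr_le (S : Finset (Fin d)) (u : EuclideanSpace ℝ (Fin d)) : ‖restr S u‖ ≤ ‖u‖ := by
  have h := norm_restr_mono (Finset.subset_univ S) u
  rwa [restr_eq_self (Finset.subset_univ _)] at h

lemma inner_restr_self (S : Finset (Fin d)) (u : EuclideanSpace ℝ (Fin d)) :
    inner ℝ (restr S u) u = ‖restr S u‖ ^ 2 := by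
  rw [norm_restr_sq, PiLp.inner_apply]
  simp [restr_apply, Finset.sum_ite_mem, sq]

end Restriction

/-! ### Index sets of largest entries. -/

section TopIndexSet

variable {d : ℕ}

lemma exists_isTopIndexSet (k : ℕ) (u : EuclideanSpace ℝ (Fin d)) :
    ∃ S, IsTopIndexSet k u S := by
  induction k with
  | zero => exact ⟨∅, by simp [IsTopIndexSet]⟩
  | succ k ih =>
    obtain ⟨S, hS, htop⟩ := ih
    rcases le_or_gt d k with hk | hk
    · exact ⟨S, by rw [hS]; omega, htop⟩
    · have hne : (Sᶜ).Nonempty := by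
        rw [← Finset.card_pos, Finset.card_compl, Fintype.card_fin, hS]; omega
      obtain ⟨a, ha, hmax⟩ := Finset.exists_max_image Sᶜ (fun j => |u j|) hne
      have ha' := Finset.mem_compl.1 ha
      refine ⟨insert a S, ?_, fun i hi j hj => ?_⟩
      · rw [Finset.card_insert_of_notMem ha', hS]; omega
      · rw [Finset.mem_insert, not_or] at hj
        rcases Finset.mem_insert.1 hi with rfl | hi
        · exact hmax j (Finset.mem_compl.2 hj.2)
        · exact htop i hi j hj.2

lemma sum_sq_le_sum_sq_of_abs_le {A B : Finset (Fin d)} (u : EuclideanSpace ℝ (Fin d))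
    (hcard : A.card ≤ B.card) (h : ∀ a ∈ A, ∀ b ∈ B, |u a| ≤ |u b|) :
    ∑ a ∈ A, u a ^ 2 ≤ ∑ b ∈ B, u b ^ 2 := by
  rcases A.eq_empty_or_nonempty with rfl | hA
  · simpa using Finset.sum_nonneg fun b _ => sq_nonneg (u b)
  · obtain ⟨a, ha, hmax⟩ := Finset.exists_max_image A (fun j => |u j|) hA
    calc ∑ i ∈ A, u i ^ 2 ≤ A.card • u a ^ 2 :=
          Finset.sum_le_card_nsmul _ _ _ fun i hi => sq_le_sq.2 (hmax i hi)
      _ ≤ B.card • u a ^ 2 := nsmul_le_nsmul_left (sq_nonneg _) hcard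
      _ ≤ _ := Finset.card_nsmul_le_sum _ _ _ fun b hb => sq_le_sq.2 (h a ha b hb)

/-- Since `T` has no more elements than `S`, also `T \ S` has no more than `S \ T`, and every entry
on the former is dominated by every entry on the latter. -/
lemma IsTopIndexSet.norm_restr_sdiff_le {k : ℕ} {u : EuclideanSpace ℝ (Fin d)}
    {S T : Finset (Fin d)} (h : IsTopIndexSet k u S) (hT : T.card ≤ k) :
    ‖restr (T \ S) u‖ ≤ ‖restr (S \ T) u‖ := by
  refine le_of_sq_le_sq ?_ (norm_nonneg _)
  rw [norm_restr_sq, norm_restr_sq]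
  refine sum_sq_le_sum_sq_of_abs_le u ?_ fun a ha b hb =>
    h.2 b (Finset.mem_sdiff.1 hb).1 a (Finset.mem_sdiff.1 ha).2
  rw [Finset.card_sdiff_le_card_sdiff_iff, h.1]
  exact le_min hT (by simpa using Finset.card_le_univ T)

end TopIndexSet

/-! ### Shelling: from sparse vectors to the mixed norm. -/

section Shelling

variable {d : ℕ}

lemma l1norm_nonneg (u : EuclideanSpace ℝ (Fin d)) : 0 ≤ l1norm u :=
  Finset.sum_nonneg fun _ _ => abs_nonneg _

lemma norm_le_l1norm (u : EuclideanSpace ℝ (Fin d)) : ‖u‖ ≤ l1norm u := by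
  refine le_of_sq_le_sq ?_ (l1norm_nonneg u)
  rw [EuclideanSpace.norm_sq_eq]
  calc ∑ j, ‖u j‖ ^ 2 ≤ ∑ j, |u j| * l1norm u := by
        refine Finset.sum_le_sum fun j _ => ?_
        rw [Real.norm_eq_abs, sq]
        exact mul_le_mul_of_nonneg_left
          (Finset.single_le_sum (f := fun j => |u j|) (fun _ _ => abs_nonneg _) (Finset.mem_univ j))
          (abs_nonneg _)
    _ = _ := by rw [← Finset.sum_mul, sq]; rfl

lemma sum_abs_le_sqrt_mul_norm (S : Finset (Fin d)) (u : EuclideanSpace ℝ (Fin d)) {s : ℕ}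
    (hS : S.card ≤ s) : ∑ j ∈ S, |u j| ≤ √(s : ℝ) * ‖u‖ := by
  refine le_of_sq_le_sq ?_ (by positivity)
  rw [mul_pow, Real.sq_sqrt (Nat.cast_nonneg s)]
  calc (∑ j ∈ S, |u j|) ^ 2 ≤ S.card * ∑ j ∈ S, |u j| ^ 2 := sq_sum_le_card_mul_sum_sq
    _ ≤ s * ‖u‖ ^ 2 := by
        have h : ∑ j ∈ S, |u j| ^ 2 ≤ ‖u‖ ^ 2 := by
          simp only [sq_abs]
          rw [← norm_restr_sq]
          gcongr
          exact norm_restr_le S u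
        gcongr

lemma l1norm_eq_add_compl (S : Finset (Fin d)) (u : EuclideanSpace ℝ (Fin d)) :
    l1norm u = ∑ j ∈ S, |u j| + ∑ j ∈ Sᶜ, |u j| :=
  (Finset.sum_add_sum_compl S _).symm

lemma l1norm_restr (S : Finset (Fin d)) (u : EuclideanSpace ℝ (Fin d)) :
    l1norm (restr S u) = ∑ j ∈ S, |u j| := by
  simp [l1norm, restr_apply, apply_ite, Finset.sum_ite_mem]

/-- An entry left out is at most the average of the selected ones; if any entry is left out, `S` has
exactly `s` elements. -/
lemma IsTopIndexSet.abs_restr_compl_le {s : ℕ} (hs : 1 ≤ s) {u : EuclideanSpace ℝ (Fin d)}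
    {S : Finset (Fin d)} (h : IsTopIndexSet s u S) (j : Fin d) :
    |restr Sᶜ u j| ≤ (∑ i ∈ S, |u i|) / s := by
  have hs0 : (0 : ℝ) < s := by exact_mod_cast hs
  by_cases hj : j ∈ S
  · simp only [restr_apply, Finset.mem_compl, hj, not_true_eq_false, if_false, abs_zero]
    exact div_nonneg (Finset.sum_nonneg fun _ _ => abs_nonneg _) hs0.le
  · simp only [restr_apply, Finset.mem_compl, hj, not_false_eq_true, if_true]
    have hc : S.card = s := by
      have h1 : S.card < d := by
        simpa using Finset.card_lt_univ_of_notMem hj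
      have := h.1
      omega
    rw [le_div_iff₀ hs0, mul_comm, ← hc, ← nsmul_eq_mul]
    exact Finset.card_nsmul_le_sum _ _ _ fun i hi => h.2 i hi j hj

/-- Blocks of `s` largest entries are peeled off one after another. The first has norm at most `√s
M`; each later one is bounded entrywise by the average of its predecessor, so its norm is at most
the predecessor's `ℓ¹` norm over `√s`. These sum to `l1norm u / √s`. -/
lemma le_of_abs_le_of_sparse {s : ℕ} (hs : 1 ≤ s) {f : EuclideanSpace ℝ (Fin d) → ℝ} {K : ℝ}
    (hK : 0 ≤ K) (hadd : ∀ u v, f (u + v) ≤ f u + f v) (hsp : ∀ u, IsSparse s u → f u ≤ K * ‖u‖)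
    (u : EuclideanSpace ℝ (Fin d)) {M : ℝ} (hM : ∀ j, |u j| ≤ M) (hM0 : 0 ≤ M) :
    f u ≤ K * (√(s : ℝ) * M + l1norm u / √(s : ℝ)) := by
  have hs0 : (0 : ℝ) < √(s : ℝ) := Real.sqrt_pos.2 (by exact_mod_cast hs)
  induction hn : (vsupp u).card using Nat.strong_induction_on generalizing u M with
  | _ n ih =>
    subst hn
    rcases eq_or_ne u 0 with rfl | hu
    · have h0 := hsp 0 (by simp [IsSparse, vsupp])
      rw [norm_zero, mul_zero] at h0
      exact h0.trans (mul_nonneg hK (add_nonneg (by positivity)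
        (div_nonneg (l1norm_nonneg _) hs0.le)))
    · obtain ⟨S, hS⟩ := exists_isTopIndexSet s u
      have hScard : S.card ≤ s := hS.1.trans_le (min_le_left _ _)
      obtain ⟨j, hj⟩ : ∃ j, u j ≠ 0 := by
        by_contra! h
        exact hu (by ext j; simp [h j])
      -- The block meets the support, so the support of the remainder shrinks and the induction
      -- applies.
      have hSj : ∃ i ∈ S, u i ≠ 0 := by
        by_cases hjS : j ∈ S
        · exact ⟨j, hjS, hj⟩
        · have hd : 0 < d := j.pos
          obtain ⟨i, hi⟩ : S.Nonempty := by
            rw [← Finset.card_pos, hS.1]; omega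
          exact ⟨i, hi, abs_pos.1 ((abs_pos.2 hj).trans_le (hS.2 i hi j hjS))⟩
      obtain ⟨i, hi, hui⟩ := hSj
      have hlt : (vsupp (restr Sᶜ u)).card < (vsupp u).card := by
        refine Finset.card_lt_card ⟨vsupp_restr_subset_vsupp _ _, fun h => ?_⟩
        have := vsupp_restr_subset _ _ (h (mem_vsupp.2 hui))
        exact Finset.mem_compl.1 this hi
      have hsum0 : 0 ≤ ∑ i ∈ S, |u i| := Finset.sum_nonneg fun _ _ => abs_nonneg _
      have hrest := ih _ hlt (restr Sᶜ u) (M := (∑ i ∈ S, |u i|) / s)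
        (hS.abs_restr_compl_le hs) (by positivity) rfl
      have hhead : ‖restr S u‖ ≤ √(s : ℝ) * M := by
        refine le_of_sq_le_sq ?_ (by positivity)
        rw [norm_restr_sq, mul_pow, Real.sq_sqrt (Nat.cast_nonneg s)]
        calc ∑ j ∈ S, u j ^ 2 ≤ S.card • M ^ 2 :=
              Finset.sum_le_card_nsmul _ _ _ fun i _ => by
                rw [← sq_abs]; gcongr; exact hM i
          _ ≤ s * M ^ 2 := by rw [nsmul_eq_mul]; gcongr
      have hdiv : √(s : ℝ) * ((∑ i ∈ S, |u i|) / s) = (∑ i ∈ S, |u i|) / √(s : ℝ) := by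
        rw [eq_div_iff hs0.ne']
        have : √(s : ℝ) * √(s : ℝ) = s := Real.mul_self_sqrt (Nat.cast_nonneg s)
        have hs1 : (s : ℝ) ≠ 0 := by positivity
        field_simp
        nlinarith
      calc f u = f (restr S u + restr Sᶜ u) := by rw [restr_add_restr_compl]
        _ ≤ f (restr S u) + f (restr Sᶜ u) := hadd _ _
        _ ≤ K * (√(s : ℝ) * M) + K * ((∑ i ∈ S, |u i|) / √(s : ℝ)
              + (∑ i ∈ Sᶜ, |u i|) / √(s : ℝ)) := by
            rw [hdiv, l1norm_restr] at hrest
            refine add_le_add ((hsp _ ?_).trans (by gcongr)) hrest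
            exact (Finset.card_le_card (vsupp_restr_subset S u)).trans hScard
        _ = _ := by rw [l1norm_eq_add_compl S u]; ring

/-- A subadditive function controlled on `s`-sparse vectors is controlled on all vectors by the
mixed norm `‖u‖₂ + ‖u‖₁ / √s`. -/
lemma le_norm_add_l1norm_of_sparse {s : ℕ} (hs : 1 ≤ s) {f : EuclideanSpace ℝ (Fin d) → ℝ}
    {K : ℝ} (hK : 0 ≤ K) (hadd : ∀ u v, f (u + v) ≤ f u + f v)
    (hsp : ∀ u, IsSparse s u → f u ≤ K * ‖u‖) (u : EuclideanSpace ℝ (Fin d)) :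
    f u ≤ K * (‖u‖ + l1norm u / √(s : ℝ)) := by
  have hs0 : (0 : ℝ) < √(s : ℝ) := Real.sqrt_pos.2 (by exact_mod_cast hs)
  obtain ⟨S, hS⟩ := exists_isTopIndexSet s u
  have hScard : S.card ≤ s := hS.1.trans_le (min_le_left _ _)
  have hsum0 : 0 ≤ ∑ i ∈ S, |u i| := Finset.sum_nonneg fun _ _ => abs_nonneg _
  have hrest := le_of_abs_le_of_sparse hs hK hadd hsp (restr Sᶜ u) (M := (∑ i ∈ S, |u i|) / s)
    (hS.abs_restr_compl_le hs) (by positivity)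
  have hdiv : √(s : ℝ) * ((∑ i ∈ S, |u i|) / s) = (∑ i ∈ S, |u i|) / √(s : ℝ) := by
    rw [eq_div_iff hs0.ne']
    have : √(s : ℝ) * √(s : ℝ) = s := Real.mul_self_sqrt (Nat.cast_nonneg s)
    have hs1 : (s : ℝ) ≠ 0 := by positivity
    field_simp
    nlinarith
  calc f u = f (restr S u + restr Sᶜ u) := by rw [restr_add_restr_compl]
    _ ≤ f (restr S u) + f (restr Sᶜ u) := hadd _ _
    _ ≤ K * ‖u‖ + K * ((∑ i ∈ S, |u i|) / √(s : ℝ) + (∑ i ∈ Sᶜ, |u i|) / √(s : ℝ)) := by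
        rw [hdiv, l1norm_restr] at hrest
        refine add_le_add ((hsp _ ?_).trans (by gcongr; exact norm_restr_le S u)) hrest
        exact (Finset.card_le_card (vsupp_restr_subset S u)).trans hScard
    _ = _ := by rw [l1norm_eq_add_compl S u]; ring

/-- The absolute defect is subadditive in each argument, so the shelling bound applies in `u` for
sparse `v`, then in `v`. The order `min (2 * s) d` suffices because supports never exceed `d`. -/
lemma IsRestrictedIsometry.abs_inner_sub_inner_le {m s : ℕ} {B : Matrix (Fin m) (Fin d) ℝ} {δ : ℝ}
    (hB : IsRestrictedIsometry B (min (2 * s) d) δ) (hδ : 0 ≤ δ) (hs : 1 ≤ s)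
    (u v : EuclideanSpace ℝ (Fin d)) :
    |inner ℝ (B.toEuclideanLin u) (B.toEuclideanLin v) - inner ℝ u v| ≤
      δ * ((‖u‖ + l1norm u / √(s : ℝ)) * (‖v‖ + l1norm v / √(s : ℝ))) := by
  have hmix (w : EuclideanSpace ℝ (Fin d)) : 0 ≤ ‖w‖ + l1norm w / √(s : ℝ) :=
    add_nonneg (norm_nonneg _) (div_nonneg (l1norm_nonneg _) (Real.sqrt_nonneg _))
  have h1 (v : EuclideanSpace ℝ (Fin d)) (hv : IsSparse s v) (u : EuclideanSpace ℝ (Fin d)) :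
      |inner ℝ (B.toEuclideanLin u) (B.toEuclideanLin v) - inner ℝ u v| ≤
        δ * ‖v‖ * (‖u‖ + l1norm u / √(s : ℝ)) := by
    refine le_norm_add_l1norm_of_sparse hs
      (f := fun u => |inner ℝ (B.toEuclideanLin u) (B.toEuclideanLin v) - inner ℝ u v|)
      (by positivity) (fun a b => ?_) (fun u hu => ?_) u
    · simp only [map_add, inner_add_left]
      refine le_trans (le_of_eq ?_) (abs_add_le _ _)
      congr 1; ring
    · refine (hB u v (le_min ?_ (by simpa using Finset.card_le_univ (vsupp u ∪ vsupp v)))).trans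
        (le_of_eq (by ring))
      have := Finset.card_union_le (vsupp u) (vsupp v)
      unfold IsSparse at hu hv
      omega
  refine (le_norm_add_l1norm_of_sparse hs
      (f := fun v => |inner ℝ (B.toEuclideanLin u) (B.toEuclideanLin v) - inner ℝ u v|)
      (K := δ * (‖u‖ + l1norm u / √(s : ℝ))) (mul_nonneg hδ (hmix u)) (fun a b => ?_)
      (fun v hv => ?_) v).trans (le_of_eq (by ring))
  · simp only [map_add, inner_add_right]
    refine le_trans (le_of_eq ?_) (abs_add_le _ _)
    congr 1; ring
  · exact (h1 v hv u).trans (le_of_eq (by ring))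

end Shelling

/-! ### Basis pursuit under RIP. -/

section BasisPursuit

variable {m d : ℕ}

lemma exists_isBasisPursuitSolution (B : Matrix (Fin m) (Fin d) ℝ) (y : EuclideanSpace ℝ (Fin m))
    (η : ℝ) (x : EuclideanSpace ℝ (Fin d)) (hx : ‖B.toEuclideanLin x - y‖ ≤ η) :
    ∃ g, IsBasisPursuitSolution B y η g := by
  have hB : Continuous B.toEuclideanLin := LinearMap.continuous_of_finiteDimensional _
  have hl1 : Continuous (l1norm (d := d)) := by unfold l1norm; fun_prop
  have hcomp : IsCompact ({z : EuclideanSpace ℝ (Fin d) | ‖B.toEuclideanLin z - y‖ ≤ η} ∩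
      {z | l1norm z ≤ l1norm x}) := by
    refine (isCompact_closedBall (0 : EuclideanSpace ℝ (Fin d)) (l1norm x)).of_isClosed_subset
      ((isClosed_le (by fun_prop) continuous_const).inter (isClosed_le hl1 continuous_const))
      fun z hz => ?_
    rw [mem_closedBall_zero_iff]
    exact (norm_le_l1norm z).trans hz.2
  obtain ⟨g, hg, hmin⟩ := hcomp.exists_isMinOn ⟨x, hx, le_refl (l1norm x)⟩ hl1.continuousOn
  refine ⟨g, hg.1, fun w hw => ?_⟩
  rcases le_total (l1norm w) (l1norm x) with h | h
  · exact hmin ⟨hw, h⟩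
  · exact hg.2.trans h

/-- The cone condition: the mass of `g` outside `vsupp x` must be compensated by a loss of mass on
it. -/
lemma l1norm_sub_le_of_l1norm_le {x g : EuclideanSpace ℝ (Fin d)} (h : l1norm g ≤ l1norm x) :
    l1norm (g - x) ≤ 2 * ∑ j ∈ vsupp x, |(g - x) j| := by
  have h1 := l1norm_eq_add_compl (vsupp x) g
  have h2 := l1norm_eq_add_compl (vsupp x) x
  have h3 := l1norm_eq_add_compl (vsupp x) (g - x)
  have hz (j : Fin d) (hj : j ∈ (vsupp x)ᶜ) : x j = 0 :=
    eq_zero_of_notMem subset_rfl (Finset.mem_compl.1 hj)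
  have h4 : ∑ j ∈ (vsupp x)ᶜ, |x j| = 0 := Finset.sum_eq_zero fun j hj => by simp [hz j hj]
  have h5 : ∑ j ∈ (vsupp x)ᶜ, |(g - x) j| = ∑ j ∈ (vsupp x)ᶜ, |g j| :=
    Finset.sum_congr rfl fun j hj => by simp [hz j hj]
  have h6 : ∑ j ∈ vsupp x, |x j| ≤ ∑ j ∈ vsupp x, |g j| + ∑ j ∈ vsupp x, |(g - x) j| := by
    rw [← Finset.sum_add_distrib]
    refine Finset.sum_le_sum fun j _ => ?_
    have := abs_sub (g j) ((g - x) j)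
    simpa using this
  linarith

theorem IsBasisPursuitSolution.norm_sub_le {s : ℕ} (hs : 1 ≤ s) {B : Matrix (Fin m) (Fin d) ℝ}
    (hB : IsRestrictedIsometry B (min (2 * s) d) (1 / 18)) {x g : EuclideanSpace ℝ (Fin d)}
    (hx : IsSparse s x) {e : EuclideanSpace ℝ (Fin m)}
    (hg : IsBasisPursuitSolution B (B.toEuclideanLin x + e) ‖e‖ g) : ‖g - x‖ ≤ 3 * ‖e‖ := by
  have hs0 : (0 : ℝ) < √(s : ℝ) := Real.sqrt_pos.2 (by exact_mod_cast hs)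
  have hl1 : l1norm g ≤ l1norm x := hg.2 x (by simp)
  have hcone : l1norm (g - x) / √(s : ℝ) ≤ 2 * ‖g - x‖ := by
    rw [div_le_iff₀ hs0]
    have := sum_abs_le_sqrt_mul_norm (vsupp x) (g - x) hx
    linarith [l1norm_sub_le_of_l1norm_le hl1]
  have hcone0 : 0 ≤ l1norm (g - x) / √(s : ℝ) := div_nonneg (l1norm_nonneg _) hs0.le
  have hBh : ‖B.toEuclideanLin (g - x)‖ ≤ 2 * ‖e‖ := by
    have h1 := hg.1
    calc ‖B.toEuclideanLin (g - x)‖ = ‖(B.toEuclideanLin g - (B.toEuclideanLin x + e)) + e‖ := by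
          rw [map_sub]; congr 1; abel
      _ ≤ _ := (norm_add_le _ _).trans (by linarith)
  have h := hB.abs_inner_sub_inner_le (by norm_num) hs (g - x) (g - x)
  rw [real_inner_self_eq_norm_sq, real_inner_self_eq_norm_sq] at h
  have h2 := (abs_le.1 h).1
  -- On the cone the mixed norm is at most `3 ‖g - x‖`, so the constant `1 / 18` bounds the defect
  -- by `‖g - x‖² / 2`. Hence `‖g - x‖² ≤ 2 (2 ‖e‖)² ≤ (3 ‖e‖)²`.
  have h3 : (‖g - x‖ + l1norm (g - x) / √(s : ℝ)) * (‖g - x‖ + l1norm (g - x) / √(s : ℝ))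
      ≤ (3 * ‖g - x‖) * (3 * ‖g - x‖) := by
    gcongr <;> linarith
  have h4 : ‖B.toEuclideanLin (g - x)‖ ^ 2 ≤ (2 * ‖e‖) ^ 2 := by gcongr
  refine le_of_sq_le_sq ?_ (by positivity)
  nlinarith

end BasisPursuit

/-! ### CoSaMP under RIP: identification, estimation, pruning, iteration. -/

section CoSaMP

variable {m d : ℕ}

lemma inner_transpose_toEuclideanLin (B : Matrix (Fin m) (Fin d) ℝ) (w : EuclideanSpace ℝ (Fin d))
    (a : EuclideanSpace ℝ (Fin m)) :
    inner ℝ w (B.transpose.toEuclideanLin a) = inner ℝ (B.toEuclideanLin w) a := by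
  rw [← Matrix.conjTranspose_eq_transpose_of_trivial, Matrix.toEuclideanLin_conjTranspose_eq_adjoint,
    LinearMap.adjoint_inner_right]

/-- A preimage of the orthogonal projection of `y` onto the image of the vectors supported in `U`;
no injectivity is needed. -/
lemma exists_isLeastSquaresOn (B : Matrix (Fin m) (Fin d) ℝ) (y : EuclideanSpace ℝ (Fin m))
    (U : Finset (Fin d)) : ∃ u, IsLeastSquaresOn B y U u := by
  set K : Submodule ℝ (EuclideanSpace ℝ (Fin m)) :=
    LinearMap.range (B.toEuclideanLin ∘ₗ restr U) with hK
  obtain ⟨z, hz⟩ : K.starProjection y ∈ K := K.starProjection_apply_mem y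
  refine ⟨restr U z, vsupp_restr_subset U z, fun w hw => ?_⟩
  have hz' : B.toEuclideanLin (restr U z) = K.starProjection y := hz
  rw [hz', Submodule.starProjection_minimal]
  have hmem : B.toEuclideanLin w ∈ K := ⟨w, by simp [restr_eq_self hw]⟩
  exact ciInf_le ⟨0, by rintro _ ⟨v, rfl⟩; exact norm_nonneg _⟩ (⟨_, hmem⟩ : K)

lemma exists_isCoSaMPStep (B : Matrix (Fin m) (Fin d) ℝ) (y : EuclideanSpace ℝ (Fin m)) (s : ℕ)
    (x : EuclideanSpace ℝ (Fin d)) : ∃ x', IsCoSaMPStep B y s x x' := by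
  obtain ⟨L, hL⟩ := exists_isTopIndexSet (2 * s)
    (B.transpose.toEuclideanLin (y - B.toEuclideanLin x))
  obtain ⟨u, hu⟩ := exists_isLeastSquaresOn B y (vsupp x ∪ L)
  obtain ⟨S, hS⟩ := exists_isTopIndexSet s u
  exact ⟨restr S u, L, u, hL, hu, S, hS, fun j => rfl⟩

lemma exists_isCoSaMPRun (B : Matrix (Fin m) (Fin d) ℝ) (y : EuclideanSpace ℝ (Fin m)) (s : ℕ) :
    ∃ x, IsCoSaMPRun B y s x := by
  choose F hF using exists_isCoSaMPStep B y s
  refine ⟨fun n => F^[n] 0, rfl, fun n => ?_⟩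
  simp only [Function.iterate_succ_apply']
  exact hF _

lemma inner_eq_zero_of_forall_norm_le {E : Type*} [NormedAddCommGroup E] [InnerProductSpace ℝ E]
    {a c : E} (h : ∀ t : ℝ, ‖a‖ ≤ ‖a - t • c‖) : inner ℝ a c = 0 := by
  rcases eq_or_ne c 0 with rfl | hc
  · simp
  · have hc0 : 0 < ‖c‖ ^ 2 := by positivity
    have h1 := pow_le_pow_left₀ (norm_nonneg a) (h (inner ℝ a c / ‖c‖ ^ 2)) 2
    rw [norm_sub_sq_real, inner_smul_right, norm_smul, mul_pow, Real.norm_eq_abs, sq_abs] at h1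
    have h2 : (inner ℝ a c / ‖c‖ ^ 2) ^ 2 * ‖c‖ ^ 2 = inner ℝ a c / ‖c‖ ^ 2 * inner ℝ a c := by
      field_simp
    have h3 : inner ℝ a c / ‖c‖ ^ 2 * inner ℝ a c ≤ 0 := by linarith
    rw [div_mul_eq_mul_div, div_le_iff₀ hc0, zero_mul] at h3
    exact mul_self_eq_zero.1 (le_antisymm h3 (mul_self_nonneg _))

lemma IsLeastSquaresOn.inner_eq_zero {B : Matrix (Fin m) (Fin d) ℝ} {y : EuclideanSpace ℝ (Fin m)}
    {U : Finset (Fin d)} {u : EuclideanSpace ℝ (Fin d)} (h : IsLeastSquaresOn B y U u)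
    {w : EuclideanSpace ℝ (Fin d)} (hw : vsupp w ⊆ U) :
    inner ℝ (y - B.toEuclideanLin u) (B.toEuclideanLin w) = 0 := by
  refine inner_eq_zero_of_forall_norm_le fun t => (h.2 (u + t • w) fun j hj => ?_).trans_eq ?_
  · by_contra hjU
    rw [mem_vsupp] at hj
    simp [eq_zero_of_notMem h.1 hjU, eq_zero_of_notMem hw hjU] at hj
  · rw [map_add, map_smul, sub_sub]

lemma IsHardThreshold.vsupp_subset {k : ℕ} {u w : EuclideanSpace ℝ (Fin d)}
    (h : IsHardThreshold k u w) : vsupp w ⊆ vsupp u := by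
  obtain ⟨S, -, hw⟩ := h
  intro j hj
  rw [mem_vsupp, hw j] at hj
  rw [mem_vsupp]
  intro h0
  simp [h0] at hj

lemma IsHardThreshold.isSparse {k : ℕ} {u w : EuclideanSpace ℝ (Fin d)}
    (h : IsHardThreshold k u w) : IsSparse k w := by
  obtain ⟨S, hS, hw⟩ := h
  refine (Finset.card_le_card fun j hj => ?_).trans (hS.1.trans_le (min_le_left k d))
  rw [mem_vsupp, hw j] at hj
  by_contra h0
  simp [h0] at hj

/-- Hard thresholding is a best sparse approximation. -/
lemma IsHardThreshold.norm_sub_le {k : ℕ} {u w z : EuclideanSpace ℝ (Fin d)}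
    (h : IsHardThreshold k u w) (hz : IsSparse k z) : ‖u - w‖ ≤ ‖u - z‖ := by
  obtain ⟨S, hS, hw⟩ := h
  have hw' : u - w = restr Sᶜ u := by
    ext j
    by_cases hj : j ∈ S <;> simp [hw j, restr_apply, hj]
  have hz' : restr (vsupp z)ᶜ (u - z) = restr (vsupp z)ᶜ u := by
    rw [map_sub, restr_eq_zero (u := z), sub_zero]
    exact fun j hj => eq_zero_of_notMem subset_rfl (Finset.mem_compl.1 hj)
  rw [hw']
  refine le_trans ?_ (norm_restr_le (vsupp z)ᶜ (u - z))
  rw [hz']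
  have hsd := pow_le_pow_left₀ (norm_nonneg _) (hS.norm_restr_sdiff_le hz) 2
  refine le_of_sq_le_sq ?_ (norm_nonneg _)
  rw [norm_restr_sq, norm_restr_sq] at hsd ⊢
  rw [← Finset.sum_sdiff (s₁ := vsupp z \ S) (s₂ := Sᶜ) (fun j hj => by simp_all),
    ← Finset.sum_sdiff (s₁ := S \ vsupp z) (s₂ := (vsupp z)ᶜ) (fun j hj => by simp_all)]
  have : Sᶜ \ (vsupp z \ S) = (vsupp z)ᶜ \ (S \ vsupp z) := by
    ext j; simp only [Finset.mem_sdiff, Finset.mem_compl]; tauto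
  rw [this]
  linarith

namespace IsRestrictedIsometry

variable {B : Matrix (Fin m) (Fin d) ℝ} {k : ℕ} {δ : ℝ}

lemma norm_le (hB : IsRestrictedIsometry B k δ) (hδ : 0 ≤ δ) {w : EuclideanSpace ℝ (Fin d)}
    (hw : (vsupp w).card ≤ k) : ‖B.toEuclideanLin w‖ ≤ (1 + δ) * ‖w‖ := by
  have h := hB w w (by rwa [Finset.union_self])
  rw [real_inner_self_eq_norm_sq, real_inner_self_eq_norm_sq] at h
  have h2 := (abs_le.1 h).2
  refine le_of_sq_le_sq ?_ (by positivity)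
  nlinarith [sq_nonneg ‖w‖, mul_nonneg hδ (sq_nonneg ‖w‖),
    mul_nonneg (mul_nonneg hδ hδ) (sq_nonneg ‖w‖)]

/-- Pairing the vector with its own restriction turns the squared norm into a polarised RIP defect;
one factor of the norm then cancels. -/
lemma norm_restr_gram_sub_le (hB : IsRestrictedIsometry B k δ) (hδ : 0 ≤ δ) {U : Finset (Fin d)}
    {r : EuclideanSpace ℝ (Fin d)} (hU : (U ∪ vsupp r).card ≤ k) :
    ‖restr U (B.transpose.toEuclideanLin (B.toEuclideanLin r) - r)‖ ≤ δ * ‖r‖ := by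
  set a := B.transpose.toEuclideanLin (B.toEuclideanLin r) - r with ha
  have h1 := inner_restr_self U a
  have h2 : inner ℝ (restr U a) a = inner ℝ (B.toEuclideanLin (restr U a)) (B.toEuclideanLin r)
      - inner ℝ (restr U a) r := by
    conv_lhs => rw [ha]
    rw [inner_sub_right, inner_transpose_toEuclideanLin]
  have h3 := hB (restr U a) r
    ((Finset.card_le_card (Finset.union_subset_union_left (vsupp_restr_subset U a))).trans hU)
  rw [← h2, h1] at h3
  rcases (norm_nonneg (restr U a)).eq_or_lt with h0 | h0
  · rw [← h0]; positivity
  · have := (le_abs_self _).trans h3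
    nlinarith

lemma norm_restr_transpose_le (hB : IsRestrictedIsometry B k δ) (hδ : 0 ≤ δ) {U : Finset (Fin d)}
    (hU : U.card ≤ k) (e : EuclideanSpace ℝ (Fin m)) :
    ‖restr U (B.transpose.toEuclideanLin e)‖ ≤ (1 + δ) * ‖e‖ := by
  set a := B.transpose.toEuclideanLin e with ha
  have h1 := inner_restr_self U a
  have h2 : inner ℝ (restr U a) a = inner ℝ (B.toEuclideanLin (restr U a)) e := by
    conv_lhs => rw [ha]
    rw [inner_transpose_toEuclideanLin]
  have h3 := real_inner_le_norm (B.toEuclideanLin (restr U a)) e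
  have h4 := hB.norm_le hδ ((Finset.card_le_card (vsupp_restr_subset U a)).trans hU)
  rcases (norm_nonneg (restr U a)).eq_or_lt with h0 | h0
  · rw [← h0]; positivity
  · have h5 : ‖B.toEuclideanLin (restr U a)‖ * ‖e‖ ≤ (1 + δ) * ‖restr U a‖ * ‖e‖ := by gcongr
    nlinarith

/-- Identification: the largest entries of the proxy capture most of the error. -/
lemma norm_restr_sdiff_le_of_isTopIndexSet {s : ℕ} (hB : IsRestrictedIsometry B (4 * s) δ)
    (hδ : 0 ≤ δ) {r : EuclideanSpace ℝ (Fin d)} {e : EuclideanSpace ℝ (Fin m)}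
    {T L : Finset (Fin d)} (hT : T.card ≤ 2 * s) (hrT : vsupp r ⊆ T)
    (hL : IsTopIndexSet (2 * s) (B.transpose.toEuclideanLin (B.toEuclideanLin r + e)) L) :
    ‖restr (T \ L) r‖ ≤ 2 * δ * ‖r‖ + 2 * (1 + δ) * ‖e‖ := by
  have hLc : L.card ≤ 2 * s := hL.1.trans_le (min_le_left _ _)
  have htop := hL.norm_restr_sdiff_le hT
  set v := B.transpose.toEuclideanLin (B.toEuclideanLin r + e) with hv
  have hdec : v = (B.transpose.toEuclideanLin (B.toEuclideanLin r) - r) + r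
      + B.transpose.toEuclideanLin e := by
    rw [hv, map_add]; abel
  -- Off `T` the proxy `v` consists only of RIP defect and noise. By the choice of `L`, this also
  -- bounds `v` on the missed set `T \ L`, where `v` is `r` up to the same two errors; hence the
  -- factors 2.
  have hLT : restr (L \ T) r = 0 := restr_eq_zero fun j hj =>
    eq_zero_of_notMem hrT (Finset.mem_sdiff.1 hj).2
  have hcLT : (L \ T).card ≤ 2 * s := (Finset.card_le_card Finset.sdiff_subset).trans hLc
  have hcTL : (T \ L).card ≤ 2 * s := (Finset.card_le_card Finset.sdiff_subset).trans hT
  have hrc : (vsupp r).card ≤ 2 * s := (Finset.card_le_card hrT).trans hT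
  have hu (V : Finset (Fin d)) (hV : V.card ≤ 2 * s) : (V ∪ vsupp r).card ≤ 4 * s :=
    (Finset.card_union_le _ _).trans (by omega)
  have h1 := hB.norm_restr_gram_sub_le hδ (hu _ hcLT)
  have h2 := hB.norm_restr_gram_sub_le hδ (hu _ hcTL)
  have h3 := hB.norm_restr_transpose_le hδ (U := L \ T) (by omega) e
  have h4 := hB.norm_restr_transpose_le hδ (U := T \ L) (by omega) e
  have hup : ‖restr (L \ T) v‖ ≤ δ * ‖r‖ + (1 + δ) * ‖e‖ := by
    rw [hdec, map_add, map_add, hLT, add_zero]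
    exact (norm_add_le _ _).trans (add_le_add h1 h3)
  have hlow : restr (T \ L) r = restr (T \ L) v
      - restr (T \ L) (B.transpose.toEuclideanLin (B.toEuclideanLin r) - r)
      - restr (T \ L) (B.transpose.toEuclideanLin e) := by
    rw [← map_sub, ← map_sub]
    congr 1
    rw [hdec]; abel
  calc ‖restr (T \ L) r‖ ≤ ‖restr (T \ L) v‖ + δ * ‖r‖ + (1 + δ) * ‖e‖ := by
        rw [hlow]
        refine (norm_sub_le _ _).trans (add_le_add ((norm_sub_le _ _).trans ?_) h4)
        exact add_le_add le_rfl h2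
    _ ≤ _ := by linarith

/-- Estimation and pruning. -/
lemma norm_sub_le_of_isLeastSquaresOn {s : ℕ} (hB : IsRestrictedIsometry B (4 * s) (1 / 100))
    {x u x' : EuclideanSpace ℝ (Fin d)} {e : EuclideanSpace ℝ (Fin m)} {U : Finset (Fin d)}
    (hU : U.card ≤ 3 * s) (hx : IsSparse s x)
    (hu : IsLeastSquaresOn B (B.toEuclideanLin x + e) U u) (hx' : IsHardThreshold s u x') :
    ‖x - x'‖ ≤ 1.1 * ‖restr Uᶜ x‖ + 2.1 * ‖e‖ := by
  set q := restr U (x - u) with hq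
  have hqU : vsupp q ⊆ U := vsupp_restr_subset U _
  have hsupp : vsupp (x - u) ⊆ U ∪ vsupp x :=
    (vsupp_sub_subset x u).trans (by
      rw [Finset.union_comm]; exact Finset.union_subset_union_left hu.1)
  have hcard : (U ∪ vsupp x).card ≤ 4 * s := by
    have := Finset.card_union_le U (vsupp x)
    unfold IsSparse at hx
    omega
  have horth := hu.inner_eq_zero hqU
  have horth' : inner ℝ (B.toEuclideanLin q) (B.toEuclideanLin (x - u))
      = -inner ℝ (B.toEuclideanLin q) e := by
    rw [real_inner_comm] at horth
    have h1 : B.toEuclideanLin x + e - B.toEuclideanLin u = B.toEuclideanLin (x - u) + e := by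
      rw [map_sub]; abel
    rw [h1, inner_add_right] at horth
    linarith
  have hself : inner ℝ q (x - u) = ‖q‖ ^ 2 := inner_restr_self U _
  have hrip := hB q (x - u) ((Finset.card_le_card (Finset.union_subset
    (hqU.trans Finset.subset_union_left) hsupp)).trans hcard)
  rw [horth', hself] at hrip
  have hrip' := (abs_le.1 hrip).1
  have hBq := hB.norm_le (by norm_num) (w := q) ((Finset.card_le_card hqU).trans (by omega))
  have hcs := (abs_le.1 (abs_real_inner_le_norm (B.toEuclideanLin q) e)).1
  have hcs2 : ‖B.toEuclideanLin q‖ * ‖e‖ ≤ (1 + 1 / 100) * ‖q‖ * ‖e‖ := by gcongr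
  have hcompl : restr Uᶜ (x - u) = restr Uᶜ x := by
    rw [map_sub, restr_eq_zero (u := u), sub_zero]
    exact fun j hj => eq_zero_of_notMem hu.1 (Finset.mem_compl.1 hj)
  have htri : ‖x - u‖ ≤ ‖q‖ + ‖restr Uᶜ x‖ := by
    conv_lhs => rw [← restr_add_restr_compl U (x - u), hcompl]
    exact norm_add_le _ _
  -- The normal equations make the residual orthogonal to `B q`, so `‖q‖²` is a RIP defect plus a
  -- noise pairing.
  have hqle : ‖q‖ ≤ 1 / 100 * ‖x - u‖ + (1 + 1 / 100) * ‖e‖ := by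
    rcases (norm_nonneg q).eq_or_lt with h0 | h0
    · rw [← h0]; positivity
    · refine le_of_mul_le_mul_left ?_ h0
      nlinarith
  have hux' : vsupp x' ⊆ U := hx'.vsupp_subset.trans hu.1
  have hbest : ‖u - x'‖ ≤ ‖u - restr U x‖ := hx'.norm_sub_le
    ((Finset.card_le_card (vsupp_restr_subset_vsupp U x)).trans hx)
  have hqeq : q = restr U x - u := by rw [hq, map_sub, restr_eq_self hu.1]
  -- Since `restr U x` is also sparse, pruning costs at most `‖u - restr U x‖ = ‖q‖`; this is the
  -- second copy of `‖q‖` below.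
  have hsplit : x - x' = restr Uᶜ x + (q + (u - x')) := by
    rw [hqeq]
    conv_lhs => rw [← restr_add_restr_compl U x]
    abel
  have hfin : ‖x - x'‖ ≤ ‖restr Uᶜ x‖ + (‖q‖ + ‖q‖) := by
    rw [hsplit]
    refine (norm_add_le _ _).trans (add_le_add le_rfl ((norm_add_le _ _).trans
      (add_le_add le_rfl (hbest.trans_eq ?_))))
    rw [hqeq, norm_sub_rev]
  have := norm_nonneg (restr Uᶜ x)
  have := norm_nonneg e
  linarith

end IsRestrictedIsometry

lemma IsCoSaMPStep.isSparse {B : Matrix (Fin m) (Fin d) ℝ} {y : EuclideanSpace ℝ (Fin m)} {s : ℕ}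
    {x x' : EuclideanSpace ℝ (Fin d)} (h : IsCoSaMPStep B y s x x') : IsSparse s x' := by
  obtain ⟨L, u, -, -, h⟩ := h
  exact h.isSparse

/-- Inserting the identification bound gives `1.1 * 0.02 ≤ 1 / 10` and `1.1 * 2.02 + 2.1 ≤ 5`. The
second conclusion has no term in `‖x - z‖`: once the support is captured, a noiseless step is exact.
-/
lemma IsCoSaMPStep.norm_sub_le {B : Matrix (Fin m) (Fin d) ℝ} {s : ℕ}
    (hB : IsRestrictedIsometry B (4 * s) (1 / 100)) {x z z' : EuclideanSpace ℝ (Fin d)}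
    {e : EuclideanSpace ℝ (Fin m)} (hx : IsSparse s x) (hz : IsSparse s z)
    (h : IsCoSaMPStep B (B.toEuclideanLin x + e) s z z') :
    ‖x - z'‖ ≤ 1 / 10 * ‖x - z‖ + 5 * ‖e‖ ∧ (vsupp x ⊆ vsupp z → ‖x - z'‖ ≤ 2.1 * ‖e‖) := by
  obtain ⟨L, u, hL, hu, ht⟩ := h
  unfold IsSparse at hz
  have hLc : L.card ≤ 2 * s := hL.1.trans_le (min_le_left _ _)
  have hUc : (vsupp z ∪ L).card ≤ 3 * s := (Finset.card_union_le _ _).trans (by omega)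
  have hstep := hB.norm_sub_le_of_isLeastSquaresOn hUc hx hu ht
  have hres : B.toEuclideanLin x + e - B.toEuclideanLin z = B.toEuclideanLin (x - z) + e := by
    rw [map_sub]; abel
  rw [hres] at hL
  have hTc : (vsupp x ∪ vsupp z).card ≤ 2 * s := by
    unfold IsSparse at hx
    exact (Finset.card_union_le _ _).trans (by omega)
  have hid := hB.norm_restr_sdiff_le_of_isTopIndexSet (by norm_num) hTc (vsupp_sub_subset x z) hL
  constructor
  · have hle : ‖restr (vsupp z ∪ L)ᶜ x‖ ≤ ‖restr ((vsupp x ∪ vsupp z) \ L) (x - z)‖ := by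
      refine le_of_sq_le_sq ?_ (norm_nonneg _)
      rw [norm_restr_sq, norm_restr_sq]
      have h1 : ∑ j ∈ (vsupp z ∪ L)ᶜ, x j ^ 2 = ∑ j ∈ vsupp x \ (vsupp z ∪ L), (x - z) j ^ 2 := by
        symm
        refine Finset.sum_subset_zero_on_sdiff (fun j hj => ?_) (fun j hj => ?_) (fun j hj => ?_)
        · simp_all
        · have : x j = 0 := by
            by_contra h0
            simp [mem_vsupp, h0] at hj
            tauto
          simp [this]
        · have : z j = 0 := by
            by_contra h0
            simp [mem_vsupp, h0] at hj
          simp [this]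
      rw [h1]
      refine Finset.sum_le_sum_of_subset_of_nonneg (fun j hj => ?_) fun _ _ _ => sq_nonneg _
      simp only [Finset.mem_sdiff, Finset.mem_union] at hj ⊢
      tauto
    have := norm_nonneg (x - z)
    have := norm_nonneg e
    linarith
  · intro hsub
    have h0 : restr (vsupp z ∪ L)ᶜ x = 0 := restr_eq_zero fun j hj =>
      eq_zero_of_notMem (hsub.trans Finset.subset_union_left) (Finset.mem_compl.1 hj)
    rwa [h0, norm_zero, mul_zero, zero_add] at hstep

lemma IsCoSaMPRun.isSparse {B : Matrix (Fin m) (Fin d) ℝ} {y : EuclideanSpace ℝ (Fin m)} {s : ℕ}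
    {g : ℕ → EuclideanSpace ℝ (Fin d)} (h : IsCoSaMPRun B y s g) (n : ℕ) : IsSparse s (g n) := by
  cases n with
  | zero => rw [h.1]; simp [IsSparse, vsupp]
  | succ n => exact (h.2 n).isSparse

/-- The constant is stable under the step because `5.6 / 10 + 5 ≤ 5.6`. -/
lemma IsCoSaMPRun.norm_sub_le {B : Matrix (Fin m) (Fin d) ℝ} {s : ℕ}
    (hB : IsRestrictedIsometry B (4 * s) (1 / 100)) {x : EuclideanSpace ℝ (Fin d)}
    {e : EuclideanSpace ℝ (Fin m)} (hx : IsSparse s x) {g : ℕ → EuclideanSpace ℝ (Fin d)}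
    (h : IsCoSaMPRun B (B.toEuclideanLin x + e) s g) (n : ℕ) :
    ‖x - g n‖ ≤ (1 / 10) ^ n * ‖x‖ + 5.6 * ‖e‖ := by
  have he := norm_nonneg e
  induction n with
  | zero => rw [h.1, sub_zero, pow_zero, one_mul]; linarith
  | succ n ih =>
    have := ((h.2 n).norm_sub_le hB hx (h.isSparse n)).1
    rw [pow_succ]
    linarith

/-- The smallest nonzero entry of `x` in absolute value serves as `a`: losing a support index costs
at least that much. -/
lemma exists_coord_lower_bound (x : EuclideanSpace ℝ (Fin d)) :
    ∃ a : ℝ, 0 < a ∧ ∀ z : EuclideanSpace ℝ (Fin d), ‖x - z‖ < a → vsupp x ⊆ vsupp z := by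
  rcases (vsupp x).eq_empty_or_nonempty with h | h
  · exact ⟨1, one_pos, fun z _ => by rw [h]; exact Finset.empty_subset _⟩
  · obtain ⟨i, hi, hmin⟩ := Finset.exists_min_image _ (fun j => |x j|) h
    refine ⟨|x i|, abs_pos.2 (mem_vsupp.1 hi), fun z hz j hj => ?_⟩
    rw [mem_vsupp]
    intro h0
    have h1 : |x j| ≤ ‖x - z‖ := by
      have := PiLp.norm_apply_le (x - z) j
      simpa [h0] using this
    exact absurd (hmin j hj) (not_le.2 (h1.trans_lt hz))

/-- The number of CoSaMP iterations needed does not depend on the matrix. -/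
lemma exists_iterations (s : ℕ) (x : EuclideanSpace ℝ (Fin d)) (e : EuclideanSpace ℝ (Fin m)) :
    ∃ N : ℕ, ∀ B : Matrix (Fin m) (Fin d) ℝ, IsRestrictedIsometry B (4 * s) (1 / 100) →
      IsSparse s x → ∀ g, IsCoSaMPRun B (B.toEuclideanLin x + e) s g → ∀ n, N ≤ n →
        ‖g n - x‖ ≤ 7.21 * ‖e‖ := by
  have hlim (a : ℝ) (ha : 0 < a) : ∃ N : ℕ, ∀ n, N ≤ n → (1 / 10 : ℝ) ^ n * ‖x‖ < a := by
    have h := (tendsto_pow_atTop_nhds_zero_of_lt_one (r := (1 / 10 : ℝ)) (by norm_num)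
      (by norm_num)).mul_const ‖x‖
    rw [zero_mul] at h
    exact Filter.eventually_atTop.1 (h.eventually (gt_mem_nhds ha))
  -- For `e = 0` the claim is exact recovery, which geometric decay alone cannot give: decay
  -- captures the support and one more step, hence `N + 1`, is exact. For `e ≠ 0`, a transient below
  -- `‖e‖` gives `1 + 5.6 ≤ 7.21`.
  rcases eq_or_ne e 0 with rfl | he
  · obtain ⟨a, ha, hsub⟩ := exists_coord_lower_bound x
    obtain ⟨N, hN⟩ := hlim a ha
    refine ⟨N + 1, fun B hB hx g hg n hn => ?_⟩
    obtain ⟨k, rfl⟩ : ∃ k, n = k + 1 := ⟨n - 1, by omega⟩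
    have hk := hg.norm_sub_le hB hx k
    rw [norm_zero, mul_zero, add_zero] at hk
    have := ((hg.2 k).norm_sub_le hB hx (hg.isSparse k)).2
      (hsub _ (hk.trans_lt (hN k (by omega))))
    rw [norm_sub_rev]
    simpa using this
  · have he0 := norm_pos_iff.2 he
    obtain ⟨N, hN⟩ := hlim ‖e‖ he0
    refine ⟨N, fun B hB hx g hg n hn => ?_⟩
    rw [norm_sub_rev]
    linarith [hg.norm_sub_le hB hx n, hN n hn]

end CoSaMP

/-! ### Large `ε`, the measurement count, and assembly. -/

lemma exists_event_of_lt_one {Ω : Type*} [MeasurableSpace Ω] (P : Measure Ω) {ε : ℝ}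
    {Q : Ω → Prop} (h : ε < 1 → ∃ E : Set Ω, MeasurableSet E ∧ 1 - ε ≤ P.real E ∧ ∀ ω ∈ E, Q ω) :
    ∃ E : Set Ω, MeasurableSet E ∧ 1 - ε ≤ P.real E ∧ ∀ ω ∈ E, Q ω := by
  rcases lt_or_ge ε 1 with hε | hε
  · exact h hε
  · exact ⟨∅, MeasurableSet.empty, by simpa using hε, by simp⟩

/-- When `2 s > d` the RIP order is `d` and the left side equals `d ≤ 2 s`, while the logarithm on
the right may drop below 1. Since `s ≤ d` it is still at least `1 - log 2 ≥ 1 / 4`, whence the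
factor 4. -/
lemma min_mul_log_le {d s : ℕ} (hs : 1 ≤ s) (hsd : s ≤ d) :
    ((min (2 * s) d : ℕ) : ℝ) * Real.log (Real.exp 1 * d / ((min (2 * s) d : ℕ) : ℝ)) ≤
      4 * (2 * s * Real.log (Real.exp 1 * d / (2 * s))) := by
  have hs0 : (0 : ℝ) < s := by exact_mod_cast hs
  have hsd' : (s : ℝ) ≤ d := by exact_mod_cast hsd
  have hd0 : (0 : ℝ) < d := hs0.trans_le hsd'
  have hlog : 1 / 4 ≤ Real.log (Real.exp 1 * d / (2 * s)) := by
    have h1 : Real.exp 1 / 2 ≤ Real.exp 1 * d / (2 * s) := by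
      rw [div_le_div_iff₀ (by norm_num) (by positivity)]
      nlinarith [Real.exp_pos 1]
    have h2 := Real.log_le_log (by positivity) h1
    rw [Real.log_div (Real.exp_pos 1).ne' (by norm_num), Real.log_exp] at h2
    linarith [Real.log_two_lt_d9]
  rcases le_total (2 * s) d with h | h
  · rw [min_eq_left h]
    push_cast
    have : 0 ≤ 2 * s * Real.log (Real.exp 1 * d / (2 * s)) := by positivity
    linarith
  · rw [min_eq_right h, mul_div_assoc, div_self hd0.ne', mul_one, Real.log_exp, mul_one]
    have : (d : ℝ) ≤ 2 * s := by exact_mod_cast h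
    nlinarith

end SparseRecovery

end

theorem mainTheorem4 (ens : SparseRecovery.Ensemble) :
    -- basis pursuit, with C = 3 and κ = 2
    (∃ C' : ℝ, 0 < C' ∧
      ∀ (d s m : ℕ), 1 ≤ s → s ≤ d →
      ∀ ε : ℝ, 0 < ε → SparseRecovery.measurementBound C' 2 d s ε ≤ (m : ℝ) →
      ∀ {Ω : Type*} [MeasurableSpace Ω] (P : MeasureTheory.Measure Ω)
        [MeasureTheory.IsProbabilityMeasure P] (A : Ω → Matrix (Fin m) (Fin d) ℝ),
      SparseRecovery.IsIIDMatrix P ens.entryLaw A →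
      ∃ E : Set Ω, MeasurableSet E ∧ 1 - ε ≤ P.real E ∧ ∀ ω ∈ E,
        ∀ (f : EuclideanSpace ℝ (Fin d) → ℝ) (x : EuclideanSpace ℝ (Fin d)),
        DifferentiableAt ℝ f x → SparseRecovery.IsSparse s (gradient f x) →
        ∀ e y : EuclideanSpace ℝ (Fin m), y = (A ω).toEuclideanLin (gradient f x) + e →
          (∃ g, SparseRecovery.IsBasisPursuitSolution ((1 / √(m : ℝ)) • A ω)
            ((1 / √(m : ℝ)) • y) ‖(1 / √(m : ℝ)) • e‖ g) ∧
          ∀ g, SparseRecovery.IsBasisPursuitSolution ((1 / √(m : ℝ)) • A ω)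
            ((1 / √(m : ℝ)) • y) ‖(1 / √(m : ℝ)) • e‖ g →
            ‖g - gradient f x‖ ≤ 3 * ‖(1 / √(m : ℝ)) • e‖) ∧
    -- CoSaMP, with C = 7.21 and κ = 4, after sufficiently many iterations
    (∃ C' : ℝ, 0 < C' ∧
      ∀ (d s m : ℕ), 1 ≤ s → 4 * s ≤ d →
      ∃ N : EuclideanSpace ℝ (Fin d) → EuclideanSpace ℝ (Fin m) → ℕ,
      ∀ ε : ℝ, 0 < ε → SparseRecovery.measurementBound C' 4 d s ε ≤ (m : ℝ) →
      ∀ {Ω : Type*} [MeasurableSpace Ω] (P : MeasureTheory.Measure Ω)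
        [MeasureTheory.IsProbabilityMeasure P] (A : Ω → Matrix (Fin m) (Fin d) ℝ),
      SparseRecovery.IsIIDMatrix P ens.entryLaw A →
      ∃ E : Set Ω, MeasurableSet E ∧ 1 - ε ≤ P.real E ∧ ∀ ω ∈ E,
        ∀ (f : EuclideanSpace ℝ (Fin d) → ℝ) (x : EuclideanSpace ℝ (Fin d)),
        DifferentiableAt ℝ f x → SparseRecovery.IsSparse s (gradient f x) →
        ∀ e y : EuclideanSpace ℝ (Fin m), y = (A ω).toEuclideanLin (gradient f x) + e →
          (∃ g, SparseRecovery.IsCoSaMPRun ((1 / √(m : ℝ)) • A ω)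
            ((1 / √(m : ℝ)) • y) s g) ∧
          ∀ g, SparseRecovery.IsCoSaMPRun ((1 / √(m : ℝ)) • A ω)
            ((1 / √(m : ℝ)) • y) s g →
            ∀ n, N (gradient f x) e ≤ n →
              ‖g n - gradient f x‖ ≤ (7.21 : ℝ) * ‖(1 / √(m : ℝ)) • e‖) := by
  have hscale {m d : ℕ} (A : Matrix (Fin m) (Fin d) ℝ) (x : EuclideanSpace ℝ (Fin d))
      (e y : EuclideanSpace ℝ (Fin m)) (hy : y = A.toEuclideanLin x + e) :
      (1 / √(m : ℝ)) • y = ((1 / √(m : ℝ)) • A).toEuclideanLin x + (1 / √(m : ℝ)) • e := by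
    rw [hy, smul_add, map_smul, LinearMap.smul_apply]
  constructor
  · obtain ⟨C, hC, h⟩ := SparseRecovery.exists_isRestrictedIsometry (1 / 18) (by norm_num)
    refine ⟨4 * C, by positivity, ?_⟩
    intro d s m hs hsd ε hε hm Ω _ P _ A hA
    refine SparseRecovery.exists_event_of_lt_one P fun hε1 => ?_
    have hbound : C * (((min (2 * s) d : ℕ) : ℝ) *
        Real.log (Real.exp 1 * d / ((min (2 * s) d : ℕ) : ℝ)) + Real.log (2 / ε)) ≤ m := by
      have hlog : 0 < Real.log (2 / ε) := Real.log_pos (by rw [lt_div_iff₀ hε]; linarith)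
      refine le_trans ?_ hm
      rw [SparseRecovery.measurementBound, mul_comm 4 C, mul_assoc]
      refine mul_le_mul_of_nonneg_left ?_ hC.le
      linarith [SparseRecovery.min_mul_log_le hs hsd]
    obtain ⟨E, hE, hPE, hrip⟩ := h ens d (min (2 * s) d) m (by omega) (min_le_right _ _) ε hε hε1
      hbound P A hA
    refine ⟨E, hE, hPE, fun ω hω f x _ hsp e y hy => ?_⟩
    rw [hscale (A ω) (gradient f x) e y hy]
    refine ⟨SparseRecovery.exists_isBasisPursuitSolution _ _ _ (gradient f x) (by simp),
      fun g hg => hg.norm_sub_le hs (hrip ω hω).2 hsp⟩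
  · obtain ⟨C, hC, h⟩ := SparseRecovery.exists_isRestrictedIsometry (1 / 100) (by norm_num)
    refine ⟨C, hC, ?_⟩
    intro d s m hs hsd
    -- `N` is fixed before `ε`, the probability space and `A`; this is possible because
    -- `exists_iterations` is uniform over all RIP matrices.
    choose N hN using fun (x : EuclideanSpace ℝ (Fin d)) (e : EuclideanSpace ℝ (Fin m)) =>
      SparseRecovery.exists_iterations s x ((1 / √(m : ℝ)) • e)
    refine ⟨N, fun ε hε hm Ω _ P _ A hA => ?_⟩
    refine SparseRecovery.exists_event_of_lt_one P fun hε1 => ?_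
    obtain ⟨E, hE, hPE, hrip⟩ := h ens d (4 * s) m (by omega) hsd ε hε hε1
      (by rw [SparseRecovery.measurementBound] at hm; push_cast; exact hm) P A hA
    refine ⟨E, hE, hPE, fun ω hω f x _ hsp e y hy => ?_⟩
    rw [hscale (A ω) (gradient f x) e y hy]
    exact ⟨SparseRecovery.exists_isCoSaMPRun _ _ s,
      fun g hg n hn => hN _ e _ (hrip ω hω).2 hsp g hg n hn⟩
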